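/- Let $d\ge 1$ be an integer, $\alpha>0$, $0<\gamma\le d$ and $s\in\mathbb R$. Write $B(x,r)=\{y\in\mathbb R^d:|x-y|<r\}$ and, for $R\ge 1$, $\mathbb A_R=\{\xi\in\mathbb R^d: R\le|\xi|\le 2R\}$. A nonnegative Borel measure $\mu$ on $\mathbb R^d$ is called $\gamma$-dimensional if there is a constant $C_\mu<\infty$ with $\mu(B(x,r))\le C_\mu r^\gamma$ for all $x\in\mathbb R^d$, $r>0$; $\langle\mu\rangle_\gamma$ denotes the infimum of such constants. With $\widehat f(\xi)=\int e^{-ix\cdot\xi}f(x)\,dx$ (extended to $L^2$), put, for $f\in L^2(\mathbb R^d)$ with $\widehat f$ compactly supported, $$e^{it(-\Delta)^{\alpha/2}}f(x)=(2\pi)^{-d}\int e^{i(x\cdot\xi+t|\xi|^\alpha)}\widehat f(\xi)\,d\xi .$$ Consider the two estimates $$\Big\|\sup_{0<t\le1}|e^{it(-\Delta)^{\alpha/2}}f|\Big\|_{L^2(B(0,1),d\mu)}\le C\,R^{\frac{d-\gamma}2+s}\,\langle\mu\rangle_\gamma^{1/2}\,\|f\|_{L^2}\qquad(1)$$ $$\Big\|\sup_{t\in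 I}|e^{it(-\Delta)^{\alpha/2}}f|\Big\|_{L^2(B(0,1),d\mu)}\le C'\,\langle\mu\rangle_\gamma^{1/2}\,R^{\frac{d-\gamma}2}\,(1+R^\alpha|I|)^{\max\{s,\frac s\alpha\}}\,\|f\|_{L^2}\qquad(2)$$ where $I\subset[0,1]$ is an interval of length $|I|$. (a) Suppose there is $C>0$ such that (1) holds for all $R\ge1$, all $\gamma$-dimensional $\mu$ and all $f\in L^2(\mathbb R^d)$ with $\widehat f$ supported in $\mathbb A_R$. Then there is $C'>0$ such that (2) holds for all $R\ge 1$, all intervals $I\subset[0,1]$ with $|I|\le\min\{R^{1-\alpha},1\}$, all $\gamma$-dimensional $\mu$ and all $f\in L^2(\mathbb R^d)$ with $\widehat f$ supported in $\mathbb A_R$. (b) Conversely, suppose that for every $\gamma$-dimensional $\mu$ there is $C'>0$ (possibly depending on $\mu$) such that (2) holds for all $R\ge1$, all intervals $I\subset[0,1]$ with $R^{-\alpha}<|I|\le\min\{R^{1-\alpha},1\}$, and all $f\in L^2(\mathbb R^d)$ with $\widehat f$ supported in $\mathbb A_R$. Then there is $C>0$ such that (1) holds for all $R\ge1$, all $\gamma$-dimensional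 $\mu$ and all $f\in L^2(\mathbb R^d)$ with $\widehat f$ supported in $\mathbb A_R$. -/

import Mathlib

open MeasureTheory Set
open scoped ENNReal NNReal FourierTransform

noncomputable section

namespace FractalMaximal

/-- `ℝ^d` with the Euclidean norm. -/
abbrev Space (d : ℕ) : Type := EuclideanSpace ℝ (Fin d)

/-- The complex Hilbert space `L²(ℝ^d)`. -/
abbrev LTwo (d : ℕ) : Type := Lp ℂ 2 (volume : Measure (Space d))

/-- The constant `C` is admissible in the ball condition
`μ(B(x,r)) ≤ C r^γ` for all `x ∈ ℝ^d` and `r > 0`. -/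
def BallBound {d : ℕ} (γ : ℝ) (μ : Measure (Space d)) (C : ℝ≥0) : Prop :=
  ∀ (x : Space d) (r : ℝ), 0 < r → μ (Metric.ball x r) ≤ C * ENNReal.ofReal (r ^ γ)

/-- A (nonnegative Borel) measure `μ` on `ℝ^d` is `γ`-dimensional. -/
def IsDimensional {d : ℕ} (γ : ℝ) (μ : Measure (Space d)) : Prop :=
  ∃ C : ℝ≥0, BallBound γ μ C

/-- `⟨μ⟩_γ`, the infimum of the admissible constants (used for `γ`-dimensional `μ` only). -/
def dimConst {d : ℕ} (γ : ℝ) (μ : Measure (Space d)) : ℝ≥0 :=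
  sInf {C : ℝ≥0 | BallBound γ μ C}

/-- The Fourier transform on `L²(ℝ^d)`, normalized by
`f̂(ξ) = ∫ f(x) e^{-i x·ξ} dx` for integrable `f`.  Mathlib's `𝓕` uses the kernel `e^{-2πi x·η}`,
whence the substitution `η = ξ / 2π`. -/
def fhat {d : ℕ} (f : LTwo d) (ξ : Space d) : ℂ :=
  (𝓕 f : LTwo d) ((2 * Real.pi)⁻¹ • ξ)

/-- `f̂` is supported in the annulus `𝔸_R = {ξ : R ≤ |ξ| ≤ 2R}` (a closed set). -/
def FourierSupportedInAnnulus {d : ℕ} (R : ℝ) (f : LTwo d) : Prop :=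
  ∀ᵐ ξ : Space d, fhat f ξ ≠ 0 → R ≤ ‖ξ‖ ∧ ‖ξ‖ ≤ 2 * R

/-- `e^{it(-Δ)^{α/2}} f(x) = (2π)^{-d} ∫ e^{i(x·ξ + t|ξ|^α)} f̂(ξ) dξ`.
The integral converges absolutely when `f ∈ L²` and `f̂` has compact support, and then it is
the continuous representative of the `L²` function with Fourier transform `e^{it|ξ|^α} f̂(ξ)`;
only such `f` are used. -/
def propagator {d : ℕ} (α t : ℝ) (f : LTwo d) (x : Space d) : ℂ :=
  (((2 * Real.pi) ^ d)⁻¹ : ℝ) *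
    ∫ ξ : Space d,
      Complex.exp (Complex.I * ((inner ℝ x ξ + t * ‖ξ‖ ^ α : ℝ) : ℂ)) * fhat f ξ

/-- `‖ sup_{t ∈ S} |e^{it(-Δ)^{α/2}} f| ‖_{L²(B(0,1), dμ)}`, as an extended nonnegative real. -/
def maximalNorm {d : ℕ} (α : ℝ) (S : Set ℝ) (μ : Measure (Space d)) (f : LTwo d) : ℝ≥0∞ :=
  eLpNorm (fun x : Space d => ⨆ t ∈ S, ‖propagator α t f x‖ₑ) 2
    (μ.restrict (Metric.ball 0 1))

/-- The frequency-localized fractal maximal estimate over `0 < t ≤ 1` with exponent `s`: the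
constant is uniform in `R ≥ 1`, in the `γ`-dimensional measure `μ`, and in `f`. -/
def MaximalEstimate (d : ℕ) (α γ s : ℝ) : Prop :=
  ∃ C : ℝ, 0 < C ∧
    ∀ R : ℝ, 1 ≤ R → ∀ μ : Measure (Space d), IsDimensional γ μ →
      ∀ f : LTwo d, FourierSupportedInAnnulus R f →
        maximalNorm α (Ioc 0 1) μ f ≤
          ENNReal.ofReal
            (C * R ^ (((d : ℝ) - γ) / 2 + s) * (dimConst γ μ : ℝ) ^ (1 / 2 : ℝ) * ‖f‖)

/-- The temporally localized bound on `I` at frequency scale `R` with constant `C`, for the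
measure `μ`.  Here `|I|` is the length (Lebesgue measure) of `I`. -/
def LocalizedBound {d : ℕ} (α γ s C R : ℝ) (I : Set ℝ) (μ : Measure (Space d)) : Prop :=
  ∀ f : LTwo d, FourierSupportedInAnnulus R f →
    maximalNorm α I μ f ≤
      ENNReal.ofReal
        (C * (dimConst γ μ : ℝ) ^ (1 / 2 : ℝ) * R ^ (((d : ℝ) - γ) / 2) *
          (1 + R ^ α * volume.real I) ^ (max s (s / α)) * ‖f‖)

end FractalMaximal

end

/-!
The two estimates are exchanged by scaling, translation and localization. Everything is done on
the Fourier side: `evolution α t g x = ∫ e^{i(x·ξ + t|ξ|^α)} g(ξ) dξ`, and `MaxBound` is the squared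
maximal inequality for `g` supported in a band `a ≤ |ξ| ≤ b` (`maximalNorm_le_iff_maxBound`).

No estimate for the convolution kernel of the propagator is needed. Multiply the evolution by a
function whose Fourier transform `q` lives in `|η| < 1/4`. This convolves in frequency, and on the
frequency side the product differs from the evolution of the convolution only by the factor
`e^{it(|ζ-η|^α - |ζ|^α)}`. At frequencies `≈ M` its phase is `O(|t| M^{α-1})`, hence bounded for the
times in which waves travel a distance `O(1)`. Expanding the exponential in its power series,
which separates `t` from the frequencies, writes the localized evolution as a rapidly converging
sum of full evolutions of functions `taylorCoeff … n` (`hasSum_taylor`), so that a maximal bound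
for the latter controls the former (`lintegral_maxEnergy_le`). Since the new functions are integrals
in `η` against `q`, their square means over a family of localizations are computed by Plancherel's
identity, for each frequency separately and without any smoothness of the symbol:

* Over all centres in space (`exists_maxBound_of_balls`), the localized pieces have total energy
  comparable to that of `g`. So bounds on unit balls give a bound on the whole space.
* Over the times `|τ| ≲ 1`, for `α ≥ 1` (`exists_maxBound_of_short_times`), the pieces inside the
  unit ball have total energy `O(M^{1-α})` times that of `g`. This local smoothing comes from the
  measure of the intersection of a shell of thickness `M^{1-α}` with a ball (`volume_shell_le`).
  So bounds on intervals of length `M^{1-α}` give a bound on the unit interval.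

For the localized estimate put `N = 1 + R^α|I|` and rescale frequency `R` to `M ≈ N^{max(1, 1/α)}`.
The rescaled time interval has length at most `1`, waves travel at most the distance `1` in it, and
the global estimate on unit balls yields the factor `M^s ≲ N^{max(s, s/α)}`.

Conversely, the constants may be taken uniform in the measure by a sliding hump argument
(`exists_uniform_maxBound`), and a wave focusing at the origin at time `0` shows that the localized
estimate forces `s ≥ 0` (`nonneg_of_uniform`). On the longest admissible intervals `N ≈ R^{min(1, α)}`
and `N^{max(s, s/α)} ≈ R^s`. These intervals have length `1` if `α ≤ 1`, while for `α ≥ 1` the bounds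
on them are put together by the localization in time. Bounded frequencies are trivial.
-/

namespace FractalMaximal

/-! ### Plancherel's identity for integrable, square integrable functions -/

section Plancherel

variable {V : Type*} [NormedAddCommGroup V] [InnerProductSpace ℝ V] [FiniteDimensional ℝ V]
  [MeasurableSpace V] [BorelSpace V]

theorem continuous_fourier {h : V → ℂ} (h1 : Integrable h) : Continuous (𝓕 h) :=
  VectorFourier.fourierIntegral_continuous Real.continuous_fourierChar
    (by exact continuous_inner) h1

/-- On `L¹ ∩ L²` the `L²` Fourier transform is given by the Fourier integral: both define the
same tempered distribution. -/
theorem fourier_toLp_ae_eq {h : V → ℂ} (h1 : Integrable h) (h2 : MemLp h 2) :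
    (𝓕 (h2.toLp h) : Lp ℂ 2 (volume : Measure V)) =ᵐ[volume] 𝓕 h := by
  refine ae_eq_of_integral_contDiff_smul_eq ?_ ?_ ?_
  · exact (Lp.memLp _).locallyIntegrable (by norm_num)
  · exact (continuous_fourier h1).locallyIntegrable
  intro g gs gc
  have hg₁ : HasCompactSupport (Complex.ofRealCLM ∘ g) := gc.comp_left rfl
  have hg₂ : ContDiff ℝ (⊤ : ℕ∞) (Complex.ofRealCLM ∘ g) :=
    Complex.ofRealCLM.contDiff.comp gs
  set G := hg₁.toSchwartzMap hg₂ with hG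
  have e1 := congrArg (fun T => T G)
    (Lp.fourier_toTemperedDistribution_eq (h2.toLp h))
  simp only [TemperedDistribution.fourier_apply, Lp.toTemperedDistribution_apply] at e1
  have e2 : ∫ x, (𝓕 G) x • (h2.toLp h) x = ∫ x, (𝓕 G) x • h x := by
    refine integral_congr_ae ?_
    filter_upwards [h2.coeFn_toLp] with x hx
    rw [hx]
  have e3 : ∫ ξ, 𝓕 (G : V → ℂ) ξ • h ξ = ∫ x, G x • 𝓕 h x := by
    have := VectorFourier.integral_fourierIntegral_smul_eq_flip (L := innerₗ V)
      (μ := volume) (ν := volume) Real.continuous_fourierChar continuous_inner G.integrable h1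
    rwa [flip_innerₗ] at this
  have e4 : ∀ x, G x = (g x : ℂ) := fun x => rfl
  calc ∫ x, g x • (𝓕 (h2.toLp h) : Lp ℂ 2 (volume : Measure V)) x
      = ∫ x, G x • (𝓕 (h2.toLp h) : Lp ℂ 2 (volume : Measure V)) x := by simp [e4]
    _ = ∫ x, (𝓕 G) x • h x := by rw [← e1, e2]
    _ = ∫ x, G x • 𝓕 h x := e3
    _ = ∫ x, g x • 𝓕 h x := by simp [e4]

theorem lintegral_enorm_sq_eq_eLpNorm_sq {X E : Type*} [MeasurableSpace X] [NormedAddCommGroup E]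
    (μ : Measure X) (h : X → E) :
    ∫⁻ x, ‖h x‖ₑ ^ 2 ∂μ = eLpNorm h 2 μ ^ 2 := by
  rw [eLpNorm_eq_lintegral_rpow_enorm_toReal (by norm_num) (by norm_num)]
  simp only [ENNReal.toReal_ofNat, ENNReal.rpow_ofNat, one_div]
  rw [← ENNReal.rpow_natCast, ← ENNReal.rpow_mul]
  norm_num

theorem lintegral_fourier_sq {h : V → ℂ} (h1 : Integrable h) (h2 : MemLp h 2) :
    ∫⁻ z, ‖𝓕 h z‖ₑ ^ 2 = ∫⁻ η, ‖h η‖ₑ ^ 2 := by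
  rw [lintegral_enorm_sq_eq_eLpNorm_sq, lintegral_enorm_sq_eq_eLpNorm_sq,
    ← eLpNorm_congr_ae (fourier_toLp_ae_eq h1 h2), ← eLpNorm_congr_ae h2.coeFn_toLp,
    ← Lp.enorm_def, ← Lp.enorm_def, ← ofReal_norm, ← ofReal_norm, Lp.norm_fourier_eq]

end Plancherel

/-! ### Evolutions of band limited functions -/

/-- The oscillatory integral `∫ e^{i(x·ξ + t|ξ|^α)} g(ξ) dξ`, that is, `(2π)^d` times the
propagator applied to the function with Fourier transform `g`. -/
noncomputable def evolution {d : ℕ} (α t : ℝ) (g : Space d → ℂ) (x : Space d) : ℂ :=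
  ∫ ξ : Space d, Complex.exp (Complex.I * ((inner ℝ x ξ + t * ‖ξ‖ ^ α : ℝ) : ℂ)) * g ξ

/-- The squared `L²` norm of a function on frequency space. -/
noncomputable def energy {d : ℕ} (g : Space d → ℂ) : ℝ≥0∞ := ∫⁻ ξ, ‖g ξ‖ₑ ^ 2

/-- The squared `L²(μ)` norm of the maximal function `sup_{t ∈ S} |evolution α t g|`. -/
noncomputable def maxEnergy {d : ℕ} (α : ℝ) (S : Set ℝ) (μ : Measure (Space d))
    (g : Space d → ℂ) : ℝ≥0∞ :=
  ∫⁻ x, (⨆ t ∈ S, ‖evolution α t g x‖ₑ) ^ 2 ∂μ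

/-- Measurable square integrable functions on frequency space which vanish outside
`{ξ : a ≤ |ξ| ≤ b}`. -/
structure Band {d : ℕ} (a b : ℝ) (g : Space d → ℂ) : Prop where
  measurable : Measurable g
  supp : ∀ ξ, g ξ ≠ 0 → a ≤ ‖ξ‖ ∧ ‖ξ‖ ≤ b
  energy_lt_top : energy g < ∞

/-- The maximal inequality over the times `S` for the frequencies `a ≤ |ξ| ≤ b`, in squared form
and with constant `K`. Restrictions to a ball are put into the measure `μ`. -/
def MaxBound {d : ℕ} (α : ℝ) (S : Set ℝ) (μ : Measure (Space d)) (a b : ℝ) (K : ℝ≥0∞) : Prop :=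
  ∀ g : Space d → ℂ, Band a b g → maxEnergy α S μ g ≤ K * energy g

section Basic

variable {d : ℕ} {α a b : ℝ} {g g' : Space d → ℂ} {S : Set ℝ} {μ : Measure (Space d)}

theorem energy_mul_unimodular {m : Space d → ℂ} (h1 : ∀ ξ, ‖m ξ‖ = 1) :
    energy (fun ξ => m ξ * g ξ) = energy g := by
  simp [energy, ← ofReal_norm, h1]

namespace Band

theorem memLp (hg : Band a b g) : MemLp g 2 := by
  refine ⟨hg.measurable.aestronglyMeasurable, ?_⟩
  have := hg.energy_lt_top
  rw [energy, lintegral_enorm_sq_eq_eLpNorm_sq] at this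
  exact (ENNReal.pow_lt_top_iff.1 this).resolve_right (by norm_num)

theorem integrable (hg : Band a b g) : Integrable g := by
  have h : IntegrableOn g (Metric.closedBall 0 b) := by
    have : IsFiniteMeasure (volume.restrict (Metric.closedBall (0 : Space d) b)) :=
      ⟨by simpa using measure_closedBall_lt_top⟩
    exact (hg.memLp.restrict _).integrable (by norm_num)
  rwa [integrableOn_iff_integrable_of_support_subset] at h
  intro ξ hξ
  simpa using (hg.supp ξ hξ).2

theorem mono {a' b' : ℝ} (hg : Band a b g) (ha : a' ≤ a) (hb : b ≤ b') : Band a' b' g :=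
  ⟨hg.measurable, fun ξ h => ⟨ha.trans (hg.supp ξ h).1, (hg.supp ξ h).2.trans hb⟩,
    hg.energy_lt_top⟩

theorem indicator (hg : Band a b g) {a' b' : ℝ} {A : Set (Space d)} (hA : MeasurableSet A)
    (h : ∀ ξ ∈ A, a ≤ ‖ξ‖ → ‖ξ‖ ≤ b → a' ≤ ‖ξ‖ ∧ ‖ξ‖ ≤ b') : Band a' b' (A.indicator g) := by
  refine ⟨hg.measurable.indicator hA, fun ξ hξ => ?_, lt_of_le_of_lt ?_ hg.energy_lt_top⟩
  · have := (Set.indicator_apply_ne_zero.1 hξ)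
    exact h ξ this.1 (hg.supp ξ this.2).1 (hg.supp ξ this.2).2
  · refine lintegral_mono fun ξ => ?_
    gcongr
    exact enorm_indicator_le_enorm_self _ _

/-- Modulations preserve bands. -/
theorem mul_unimodular (hg : Band a b g) {m : Space d → ℂ} (hm : Measurable m)
    (h1 : ∀ ξ, ‖m ξ‖ = 1) : Band a b (fun ξ => m ξ * g ξ) := by
  refine ⟨hm.mul hg.measurable, fun ξ hξ => hg.supp ξ (right_ne_zero_of_mul hξ), ?_⟩
  rw [energy_mul_unimodular h1]
  exact hg.energy_lt_top

end Band

theorem MaxBound.mono {S' : Set ℝ} {a' b' : ℝ} {K K' : ℝ≥0∞} {μ' : Measure (Space d)}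
    (h : MaxBound α S μ a b K) (hS : S' ⊆ S) (hμ : μ' ≤ μ) (ha : a ≤ a') (hb : b' ≤ b)
    (hK : K ≤ K') : MaxBound α S' μ' a' b' K' := by
  intro g hg
  calc maxEnergy α S' μ' g ≤ maxEnergy α S μ g := by
        refine lintegral_mono' hμ fun x => ?_
        have : (⨆ t ∈ S', ‖evolution α t g x‖ₑ) ≤ ⨆ t ∈ S, ‖evolution α t g x‖ₑ := biSup_mono hS
        gcongr
    _ ≤ K * energy g := h g (hg.mono ha hb)
    _ ≤ K' * energy g := by gcongr

theorem norm_phase (r : ℝ) : ‖Complex.exp (Complex.I * (r : ℂ))‖ = 1 := by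
  rw [mul_comm]; exact Complex.norm_exp_ofReal_mul_I r

theorem enorm_phase (r : ℝ) : ‖Complex.exp (Complex.I * (r : ℂ))‖ₑ = 1 := by
  rw [← ofReal_norm, norm_phase, ENNReal.ofReal_one]

theorem measurable_norm_rpow (α : ℝ) : Measurable fun ξ : Space d => ‖ξ‖ ^ α :=
  measurable_norm.pow_const α

theorem measurable_phase (α t : ℝ) (x : Space d) : Measurable fun ξ : Space d =>
    Complex.exp (Complex.I * ((inner ℝ x ξ + t * ‖ξ‖ ^ α : ℝ) : ℂ)) := by
  have := measurable_norm_rpow (d := d) α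
  fun_prop

theorem integrable_phase_mul (hg : Integrable g) (α t : ℝ) (x : Space d) :
    Integrable fun ξ : Space d =>
      Complex.exp (Complex.I * ((inner ℝ x ξ + t * ‖ξ‖ ^ α : ℝ) : ℂ)) * g ξ := by
  refine hg.bdd_mul (c := 1) (measurable_phase α t x).aestronglyMeasurable ?_
  exact .of_forall fun ξ => (norm_phase _).le

theorem continuous_evolution (hg : Integrable g) (α : ℝ) :
    Continuous fun p : ℝ × Space d => evolution α p.1 g p.2 := by
  refine continuous_of_dominated (bound := fun ξ => ‖g ξ‖) ?_ ?_ hg.norm ?_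
  · exact fun p => (integrable_phase_mul hg α p.1 p.2).aestronglyMeasurable
  · exact fun p => .of_forall fun ξ => by rw [norm_mul, norm_phase, one_mul]
  · exact .of_forall fun ξ => by fun_prop

theorem evolution_add (hg : Integrable g) (hg' : Integrable g') (t : ℝ) (x : Space d) :
    evolution α t (fun ξ => g ξ + g' ξ) x = evolution α t g x + evolution α t g' x := by
  unfold evolution
  rw [← integral_add (integrable_phase_mul hg α t x) (integrable_phase_mul hg' α t x)]
  simp only [mul_add]

theorem enorm_evolution_le (t : ℝ) (x : Space d) :
    ‖evolution α t g x‖ₑ ≤ ∫⁻ ξ, ‖g ξ‖ₑ := by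
  refine (enorm_integral_le_lintegral_enorm _).trans_eq (lintegral_congr fun ξ => ?_)
  rw [enorm_mul, enorm_phase, one_mul]

theorem measurable_maximal (hg : Integrable g) (α : ℝ) (S : Set ℝ) :
    Measurable fun x => ⨆ t ∈ S, ‖evolution α t g x‖ₑ := by
  refine LowerSemicontinuous.measurable ?_
  refine lowerSemicontinuous_biSup fun t _ => Continuous.lowerSemicontinuous ?_
  exact ((continuous_evolution hg α).comp (by fun_prop : Continuous fun x => (t, x))).enorm

theorem add_sq_le_two_mul (u v : ℝ≥0∞) : (u + v) ^ 2 ≤ 2 * (u ^ 2 + v ^ 2) := by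
  have := ENNReal.rpow_add_le_mul_rpow_add_rpow u v (p := 2) (by norm_num)
  norm_num at this
  exact this

/-- A band may be cut into two. -/
theorem MaxBound.union {c : ℝ} {K K' : ℝ≥0∞} (h : MaxBound α S μ a c K)
    (h' : MaxBound α S μ c b K') : MaxBound α S μ a b (2 * (K + K')) := by
  intro g hg
  set A : Set (Space d) := {ξ | ‖ξ‖ ≤ c} with hAdef
  have hA : MeasurableSet A := measurableSet_le measurable_norm measurable_const
  have b1 : Band a c (A.indicator g) := hg.indicator hA fun ξ h1 h2 _ => ⟨h2, h1⟩
  have b2 : Band c b (Aᶜ.indicator g) := hg.indicator hA.compl fun ξ h1 _ h2 =>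
    ⟨(not_le.1 (show ¬ ‖ξ‖ ≤ c from h1)).le, h2⟩
  have hsum : g = fun ξ => A.indicator g ξ + Aᶜ.indicator g ξ := by
    funext ξ; exact (congrFun (Set.indicator_self_add_compl A g) ξ).symm
  have he : energy (A.indicator g) ≤ energy g := lintegral_mono fun ξ => by
    gcongr; exact enorm_indicator_le_enorm_self _ _
  have he' : energy (Aᶜ.indicator g) ≤ energy g := lintegral_mono fun ξ => by
    gcongr; exact enorm_indicator_le_enorm_self _ _
  calc maxEnergy α S μ g
      ≤ ∫⁻ x, 2 * ((⨆ t ∈ S, ‖evolution α t (A.indicator g) x‖ₑ) ^ 2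
          + (⨆ t ∈ S, ‖evolution α t (Aᶜ.indicator g) x‖ₑ) ^ 2) ∂μ := by
        refine lintegral_mono fun x => le_trans ?_ (add_sq_le_two_mul _ _)
        gcongr
        refine iSup₂_le fun t ht => ?_
        conv_lhs => rw [hsum]
        rw [evolution_add b1.integrable b2.integrable]
        refine (enorm_add_le _ _).trans ?_
        gcongr
        · exact le_biSup (fun t => ‖evolution α t (A.indicator g) x‖ₑ) ht
        · exact le_biSup (fun t => ‖evolution α t (Aᶜ.indicator g) x‖ₑ) ht
    _ = 2 * (maxEnergy α S μ (A.indicator g) + maxEnergy α S μ (Aᶜ.indicator g)) := by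
        rw [lintegral_const_mul', lintegral_add_left]
        · rfl
        · exact (measurable_maximal b1.integrable α S).pow_const 2
        · norm_num
    _ ≤ 2 * (K * energy g + K' * energy g) := by
        gcongr
        · exact (h _ b1).trans (by gcongr)
        · exact (h' _ b2).trans (by gcongr)
    _ = 2 * (K + K') * energy g := by ring

end Basic

/-! ### Localization by multipliers with compactly supported Fourier transform -/

/-- The coefficient of `(itL)^n / n!` in the expansion of
`∫ q(η) g(ζ - η) e^{it(|ζ - η|^α - |ζ|^α)} dη`, the integral being over the ball `|η| < 1/4`. The
scale `L > 0` is chosen such that the base of the power is at most `1` (see `SlowSymbol`). For `n = 0` this is the convolution of `g` with the cut-off of `q`, i.e. multiplication by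
a fixed function in physical space. -/
noncomputable def taylorCoeff {d : ℕ} (α L : ℝ) (q g : Space d → ℂ) (n : ℕ) (ζ : Space d) : ℂ :=
  ∫ η in Metric.ball (0 : Space d) (1 / 4),
    q η * g (ζ - η) * (((‖ζ - η‖ ^ α - ‖ζ‖ ^ α) / L : ℝ) : ℂ) ^ n

/-- On the band `a ≤ |ξ| ≤ b` a frequency shift by less than `1/4` changes `|ξ|^α` by at most
`L`. -/
def SlowSymbol (d : ℕ) (α a b L : ℝ) : Prop :=
  0 < L ∧ ∀ ξ η : Space d, a ≤ ‖ξ‖ → ‖ξ‖ ≤ b → ‖η‖ < 1 / 4 → |‖ξ‖ ^ α - ‖ξ + η‖ ^ α| ≤ L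

section Taylor

variable {d : ℕ} {α a b L : ℝ} {q g : Space d → ℂ}

theorem measurable_taylor_integrand (hq : Measurable q) (hg : Measurable g) (α L : ℝ) (n : ℕ) :
    Measurable fun p : Space d × Space d =>
      q p.2 * g (p.1 - p.2) * (((‖p.1 - p.2‖ ^ α - ‖p.1‖ ^ α) / L : ℝ) : ℂ) ^ n := by
  have := measurable_norm_rpow (d := d) α
  have h1 : Measurable fun p : Space d × Space d => ‖p.1 - p.2‖ ^ α :=
    this.comp (measurable_fst.sub measurable_snd)
  have h2 : Measurable fun p : Space d × Space d => ‖p.1‖ ^ α := this.comp measurable_fst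
  have h3 : Measurable fun p : Space d × Space d => g (p.1 - p.2) :=
    hg.comp (measurable_fst.sub measurable_snd)
  have h4 : Measurable fun p : Space d × Space d => q p.2 := hq.comp measurable_snd
  fun_prop

theorem norm_taylor_integrand_le (hS : SlowSymbol d α a b L) (hg : Band a b g)
    (hq1 : ∀ η, ‖q η‖ ≤ 1) (n : ℕ) (ζ η : Space d) (hη : ‖η‖ < 1 / 4) :
    ‖q η * g (ζ - η) * (((‖ζ - η‖ ^ α - ‖ζ‖ ^ α) / L : ℝ) : ℂ) ^ n‖ ≤ ‖g (ζ - η)‖ := by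
  by_cases h0 : g (ζ - η) = 0
  · simp [h0]
  obtain ⟨ha, hb⟩ := hg.supp _ h0
  have h := hS.2 (ζ - η) η ha hb hη
  rw [sub_add_cancel] at h
  rw [norm_mul, norm_mul, norm_pow, Complex.norm_real, Real.norm_eq_abs, abs_div,
    abs_of_pos hS.1]
  have h1 : (|‖ζ - η‖ ^ α - ‖ζ‖ ^ α| / L) ^ n ≤ 1 :=
    pow_le_one₀ (div_nonneg (abs_nonneg _) hS.1.le) ((div_le_one hS.1).2 h)
  calc _ ≤ 1 * ‖g (ζ - η)‖ * 1 := by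
        gcongr
        · exact pow_nonneg (div_nonneg (abs_nonneg _) hS.1.le) n
        · exact hq1 η
    _ = _ := by ring

theorem integrable_comp_sub (hg : Integrable g) :
    Integrable (fun p : Space d × Space d => g (p.1 - p.2))
      (volume.prod (volume.restrict (Metric.ball 0 (1 / 4)))) := by
  have : IsFiniteMeasure (volume.restrict (Metric.ball (0 : Space d) (1 / 4))) :=
    ⟨by simpa using measure_ball_lt_top⟩
  have h := measurePreserving_sub_prod (volume : Measure (Space d))
    (volume.restrict (Metric.ball (0 : Space d) (1 / 4)))
  exact h.integrable_comp_of_integrable (hg.comp_fst _)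

theorem ae_prod_norm_lt : ∀ᵐ p : Space d × Space d
    ∂volume.prod (volume.restrict (Metric.ball 0 (1 / 4))), ‖p.2‖ < 1 / 4 := by
  have h : ∀ᵐ η ∂(volume.restrict (Metric.ball (0 : Space d) (1 / 4))), ‖η‖ < 1 / 4 := by
    filter_upwards [ae_restrict_mem Metric.isOpen_ball.measurableSet] with η hη
    simpa using hη
  exact Measure.quasiMeasurePreserving_snd.ae h

theorem integrable_taylor_integrand (hS : SlowSymbol d α a b L) (hg : Band a b g)
    (hq : Measurable q) (hq1 : ∀ η, ‖q η‖ ≤ 1) (n : ℕ) :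
    Integrable (fun p : Space d × Space d =>
      q p.2 * g (p.1 - p.2) * (((‖p.1 - p.2‖ ^ α - ‖p.1‖ ^ α) / L : ℝ) : ℂ) ^ n)
      (volume.prod (volume.restrict (Metric.ball 0 (1 / 4)))) := by
  refine (integrable_comp_sub hg.integrable).mono
    (measurable_taylor_integrand hq hg.measurable α L n).aestronglyMeasurable ?_
  filter_upwards [ae_prod_norm_lt] with p hp
  exact norm_taylor_integrand_le hS hg hq1 n p.1 p.2 hp

/-- Multiplication by the function with Fourier transform `q 1_{|η|<1/4}` almost commutes with
the evolution: the difference of the phases is expanded in a power series, each term of which is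
a full evolution. -/
theorem hasSum_taylor (hS : SlowSymbol d α a b L) (hg : Band a b g)
    (hq : Measurable q) (hq1 : ∀ η, ‖q η‖ ≤ 1) (t : ℝ) (x : Space d) :
    HasSum (fun n : ℕ => (Complex.I * (t * L : ℝ)) ^ n / (n.factorial : ℂ) *
        evolution α t (taylorCoeff α L q g n) x)
      ((∫ η in Metric.ball (0 : Space d) (1 / 4),
          Complex.exp (Complex.I * (inner ℝ x η : ℝ)) * q η) * evolution α t g x) := by
  set ν := (volume : Measure (Space d)).restrict (Metric.ball 0 (1 / 4)) with hν
  have hfin : IsFiniteMeasure ν := ⟨by simpa [hν] using measure_ball_lt_top⟩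
  set B : ℕ → Space d × Space d → ℂ := fun n p =>
    q p.2 * g (p.1 - p.2) * (((‖p.1 - p.2‖ ^ α - ‖p.1‖ ^ α) / L : ℝ) : ℂ) ^ n with hB
  set c : ℕ → ℂ := fun n => (Complex.I * (t * L : ℝ)) ^ n / (n.factorial : ℂ) with hc
  set e : Space d → ℂ := fun ζ =>
    Complex.exp (Complex.I * ((inner ℝ x ζ + t * ‖ζ‖ ^ α : ℝ) : ℂ)) with he
  have hem : Measurable e := measurable_phase α t x
  set F : ℕ → Space d × Space d → ℂ := fun n p => c n * (e p.1 * B n p) with hF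
  have hBint : ∀ n, Integrable (B n) (volume.prod ν) := fun n =>
    integrable_taylor_integrand hS hg hq hq1 n
  have hEB : ∀ n, Integrable (fun p => e p.1 * B n p) (volume.prod ν) := fun n =>
    (hBint n).bdd_mul (c := 1) (hem.comp measurable_fst).aestronglyMeasurable
      (.of_forall fun p => (norm_phase _).le)
  have hFint : ∀ n, Integrable (F n) (volume.prod ν) := fun n => (hEB n).const_mul _
  set J := ∫ p : Space d × Space d, ‖g (p.1 - p.2)‖ ∂(volume.prod ν) with hJ
  have hnorm : ∀ n, ∫ p, ‖F n p‖ ∂(volume.prod ν) ≤ |t * L| ^ n / n.factorial * J := by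
    intro n
    rw [hJ, ← integral_const_mul]
    refine integral_mono_ae (hFint n).norm
      ((integrable_comp_sub hg.integrable).norm.const_mul _) ?_
    filter_upwards [ae_prod_norm_lt] with p hp
    have h1 := norm_taylor_integrand_le hS hg hq1 n p.1 p.2 hp
    have h2 : ‖c n‖ = |t * L| ^ n / n.factorial := by
      simp [hc, mul_pow, abs_mul]
    simp only [hF, norm_mul, h2]
    have h3 : ‖e p.1‖ = 1 := norm_phase _
    rw [h3, one_mul]
    gcongr
  have hsum : Summable fun n => ∫ p, ‖F n p‖ ∂(volume.prod ν) :=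
    Summable.of_nonneg_of_le (fun n => integral_nonneg fun _ => norm_nonneg _) hnorm
      ((Real.summable_pow_div_factorial _).mul_right J)
  have key := hasSum_integral_of_summable_integral_norm hFint hsum
  have hterm : ∀ n, ∫ p, F n p ∂(volume.prod ν) =
      c n * evolution α t (taylorCoeff α L q g n) x := by
    intro n
    simp only [hF]
    rw [integral_const_mul, integral_prod _ (hEB n)]
    congr 1
    unfold evolution taylorCoeff
    refine integral_congr_ae (.of_forall fun ζ => ?_)
    exact integral_const_mul (e ζ) (fun η => B n (ζ, η))
  have htot : ∫ p, ∑' n, F n p ∂(volume.prod ν) =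
      (∫ η, Complex.exp (Complex.I * (inner ℝ x η : ℝ)) * q η ∂ν) * evolution α t g x := by
    set G : Space d × Space d → ℂ := fun p =>
      (e p.1 * g p.1) * (Complex.exp (Complex.I * (inner ℝ x p.2 : ℝ)) * q p.2) with hG
    have hpt : ∀ p : Space d × Space d, ∑' n, F n p = G (p.1 - p.2, p.2) := by
      intro p
      set r : ℝ := ‖p.1 - p.2‖ ^ α - ‖p.1‖ ^ α with hr
      have h1 : HasSum (fun n => (Complex.I * ((t * r : ℝ) : ℂ)) ^ n / (n.factorial : ℂ))
          (Complex.exp (Complex.I * ((t * r : ℝ) : ℂ))) := by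
        rw [Complex.exp_eq_exp_ℂ]
        exact NormedSpace.expSeries_div_hasSum_exp (𝔸 := ℂ) _
      have h2 := (h1.mul_left (e p.1 * (q p.2 * g (p.1 - p.2)))).tsum_eq
      have h3 : ∀ n, F n p = e p.1 * (q p.2 * g (p.1 - p.2)) *
          ((Complex.I * ((t * r : ℝ) : ℂ)) ^ n / (n.factorial : ℂ)) := by
        intro n
        have hL : (L : ℂ) ≠ 0 := by exact_mod_cast hS.1.ne'
        simp only [hF, hc, hB, ← hr, Complex.ofReal_mul, Complex.ofReal_div, mul_pow, div_pow]
        field_simp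
      simp only [h3, h2]
      have h4 : e p.1 * Complex.exp (Complex.I * ((t * r : ℝ) : ℂ)) =
          e (p.1 - p.2) * Complex.exp (Complex.I * (inner ℝ x p.2 : ℝ)) := by
        simp only [he, ← Complex.exp_add, hr, inner_sub_right]
        congr 1
        push_cast
        ring
      simp only [hG]
      linear_combination (q p.2 * g (p.1 - p.2)) * h4
    have hGm : AEStronglyMeasurable G (volume.prod ν) := by
      have := hg.measurable
      exact Measurable.aestronglyMeasurable (by fun_prop)
    have hmp := measurePreserving_sub_prod (volume : Measure (Space d)) ν
    calc ∫ p, ∑' n, F n p ∂(volume.prod ν)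
        = ∫ p : Space d × Space d, G (p.1 - p.2, p.2) ∂(volume.prod ν) := by
          simp only [hpt]
      _ = ∫ p, G p ∂(volume.prod ν) := by
          conv_rhs => rw [← hmp.map_eq]
          rw [integral_map hmp.aemeasurable (by rw [hmp.map_eq]; exact hGm)]
      _ = _ := by
          rw [mul_comm]
          exact integral_prod_mul (fun ξ => e ξ * g ξ)
            (fun η => Complex.exp (Complex.I * (inner ℝ x η : ℝ)) * q η)
  rw [htot] at key
  simpa only [hterm] using key

end Taylor

/-! ### Averaged localization -/

theorem sq_lintegral_le {X : Type*} [MeasurableSpace X] (μ : Measure X) {u : X → ℝ≥0∞}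
    (hu : AEMeasurable u μ) : (∫⁻ x, u x ∂μ) ^ 2 ≤ μ univ * ∫⁻ x, u x ^ 2 ∂μ := by
  have h := ENNReal.lintegral_mul_le_Lp_mul_Lq μ (p := 2) (q := 2)
    (by constructor <;> norm_num) hu (aemeasurable_const (b := (1 : ℝ≥0∞)))
  have e : ∀ y : ℝ≥0∞, (y ^ (1 / (2 : ℝ))) ^ 2 = y := fun y => by
    rw [← ENNReal.rpow_natCast, ← ENNReal.rpow_mul]; norm_num
  have h2 := pow_le_pow_left₀ (by positivity) h 2
  rw [mul_pow, e, e] at h2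
  simpa [mul_comm] using h2

theorem sq_tsum_mul_le (w u : ℕ → ℝ≥0∞) :
    (∑' n, w n * u n) ^ 2 ≤ (∑' n, w n) * ∑' n, w n * u n ^ 2 := by
  have h := sq_lintegral_le (Measure.count.withDensity w) (u := u) (by fun_prop)
  simpa [lintegral_withDensity_eq_lintegral_mul, Measurable.of_discrete, lintegral_count,
    withDensity_apply] using h

/-- An oscillatory integral shows no cancellation as long as the phase is at most `1`. -/
theorem half_le_norm_integral_phase {X : Type*} [MeasurableSpace X] (ν : Measure X)
    [IsFiniteMeasure ν] {φ : X → ℝ} (hφ : Measurable φ) (h1 : ∀ᵐ x ∂ν, |φ x| ≤ 1) :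
    ν.real univ / 2 ≤ ‖∫ x, Complex.exp (Complex.I * (φ x : ℂ)) ∂ν‖ := by
  have hint : Integrable (fun x => Complex.exp (Complex.I * (φ x : ℂ))) ν := by
    refine Integrable.of_bound (by fun_prop) 1 (.of_forall fun x => (norm_phase _).le)
  refine le_trans ?_ (Complex.re_le_norm _)
  have hre : (∫ x, Complex.exp (Complex.I * (φ x : ℂ)) ∂ν).re = ∫ x, Real.cos (φ x) ∂ν := by
    have := integral_re hint
    simp only [RCLike.re_eq_complex_re] at this
    rw [← this]
    refine integral_congr_ae (.of_forall fun x => ?_)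
    simp only
    rw [mul_comm, Complex.exp_ofReal_mul_I_re]
  rw [hre]
  calc ν.real univ / 2 = ∫ _, (1 / 2 : ℝ) ∂ν := by simp; ring
    _ ≤ _ := by
      refine integral_mono_ae (integrable_const _) ?_ ?_
      · exact Integrable.of_bound (by fun_prop) 1 (.of_forall fun x => by
          simpa using Real.abs_cos_le_one (φ x))
      · filter_upwards [h1] with x hx
        have := Real.one_sub_sq_div_two_le_cos (x := φ x)
        have h2 : φ x ^ 2 ≤ 1 := by rw [← sq_abs]; exact pow_le_one₀ (abs_nonneg _) hx
        linarith

section Averages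

variable {d : ℕ} {α a b L : ℝ}

theorem measurable_taylorCoeff_prod {P : Type*} [MeasurableSpace P] {q g : P → Space d → ℂ}
    (hq : Measurable fun p : P × Space d => q p.1 p.2)
    (hg : Measurable fun p : P × Space d => g p.1 p.2) (α L : ℝ) (n : ℕ) :
    Measurable fun p : P × Space d => taylorCoeff α L (q p.1) (g p.1) n p.2 := by
  have := measurable_norm_rpow (d := d) α
  have h1 : Measurable fun p : (P × Space d) × Space d => ‖p.1.2 - p.2‖ ^ α :=
    this.comp (by fun_prop)
  have h2 : Measurable fun p : (P × Space d) × Space d => ‖p.1.2‖ ^ α := this.comp (by fun_prop)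
  have h3 : Measurable fun p : (P × Space d) × Space d => g p.1.1 (p.1.2 - p.2) :=
    hg.comp (by fun_prop : Measurable fun p : (P × Space d) × Space d => (p.1.1, p.1.2 - p.2))
  have h4 : Measurable fun p : (P × Space d) × Space d => q p.1.1 p.2 :=
    hq.comp (by fun_prop : Measurable fun p : (P × Space d) × Space d => (p.1.1, p.2))
  refine StronglyMeasurable.measurable (StronglyMeasurable.integral_prod_right
    (f := fun (p : P × Space d) (η : Space d) => q p.1 η * g p.1 (p.2 - η) *
      (((‖p.2 - η‖ ^ α - ‖p.2‖ ^ α) / L : ℝ) : ℂ) ^ n) ?_)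
  refine Measurable.stronglyMeasurable ?_
  simp only [Function.uncurry_def]
  fun_prop

theorem measurable_taylorCoeff {q g : Space d → ℂ} (hq : Measurable q) (hg : Measurable g)
    (α L : ℝ) (n : ℕ) : Measurable (taylorCoeff α L q g n) := by
  refine StronglyMeasurable.measurable (StronglyMeasurable.integral_prod_right
    (f := fun (ζ : Space d) (η : Space d) => q η * g (ζ - η) *
      (((‖ζ - η‖ ^ α - ‖ζ‖ ^ α) / L : ℝ) : ℂ) ^ n) ?_)
  exact (measurable_taylor_integrand hq hg α L n).stronglyMeasurable

theorem lintegral_lintegral_ball_sub {u : Space d → ℝ≥0∞} (hu : Measurable u) :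
    ∫⁻ ζ, ∫⁻ η in Metric.ball (0 : Space d) (1 / 4), u (ζ - η) =
      volume (Metric.ball (0 : Space d) (1 / 4)) * ∫⁻ ξ, u ξ := by
  rw [lintegral_lintegral_swap (by
    exact (hu.comp (measurable_fst.sub measurable_snd)).aemeasurable)]
  simp only [lintegral_sub_right_eq_self]
  simp [mul_comm]

theorem enorm_taylorCoeff_sq_le {q g : Space d → ℂ} (hS : SlowSymbol d α a b L) (hg : Band a b g)
    (hq1 : ∀ η, ‖q η‖ ≤ 1) (n : ℕ) (ζ : Space d) :
    ‖taylorCoeff α L q g n ζ‖ₑ ^ 2 ≤ volume (Metric.ball (0 : Space d) (1 / 4)) *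
      ∫⁻ η in Metric.ball (0 : Space d) (1 / 4), ‖g (ζ - η)‖ₑ ^ 2 := by
  have hm : Measurable fun η => ‖g (ζ - η)‖ₑ :=
    (hg.measurable.comp (measurable_const.sub measurable_id)).enorm
  have h1 : ‖taylorCoeff α L q g n ζ‖ₑ ≤
      ∫⁻ η in Metric.ball (0 : Space d) (1 / 4), ‖g (ζ - η)‖ₑ := by
    refine (enorm_integral_le_lintegral_enorm _).trans ?_
    refine setLIntegral_mono hm fun η hη => ?_
    rw [← ofReal_norm, ← ofReal_norm]
    exact ENNReal.ofReal_le_ofReal (norm_taylor_integrand_le hS hg hq1 n ζ η (by simpa using hη))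
  refine (pow_le_pow_left₀ (by positivity) h1 2).trans ?_
  simpa using sq_lintegral_le (volume.restrict (Metric.ball (0 : Space d) (1 / 4)))
    (u := fun η => ‖g (ζ - η)‖ₑ) hm.aemeasurable

/-- The Taylor coefficients live in a slightly larger band. -/
theorem Band.taylorCoeff {q g : Space d → ℂ} (hg : Band a b g) (hS : SlowSymbol d α a b L)
    (hq : Measurable q) (hq1 : ∀ η, ‖q η‖ ≤ 1) (n : ℕ) :
    Band (a - 1 / 4) (b + 1 / 4) (taylorCoeff α L q g n) := by
  refine ⟨measurable_taylorCoeff hq hg.measurable α L n, fun ζ hζ => ?_, ?_⟩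
  · by_contra hcon
    refine hζ (setIntegral_eq_zero_of_forall_eq_zero fun η hη => ?_)
    have hη' : ‖η‖ < 1 / 4 := by simpa using hη
    have : g (ζ - η) = 0 := by
      by_contra h0
      obtain ⟨h1, h2⟩ := hg.supp _ h0
      have h3 := norm_sub_le ζ η
      have h4 := norm_le_norm_sub_add ζ η
      exact hcon ⟨by linarith, by linarith⟩
    simp [this]
  · calc energy (FractalMaximal.taylorCoeff α L q g n)
        ≤ ∫⁻ ζ, volume (Metric.ball (0 : Space d) (1 / 4)) *
          ∫⁻ η in Metric.ball (0 : Space d) (1 / 4), ‖g (ζ - η)‖ₑ ^ 2 :=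
        lintegral_mono fun ζ => enorm_taylorCoeff_sq_le hS hg hq1 n ζ
      _ = volume (Metric.ball (0 : Space d) (1 / 4)) *
          (volume (Metric.ball (0 : Space d) (1 / 4)) * energy g) := by
        rw [lintegral_const_mul' _ _ measure_ball_lt_top.ne,
          lintegral_lintegral_ball_sub (u := fun ξ => ‖g ξ‖ₑ ^ 2) (hg.measurable.enorm.pow_const 2)]
        rfl
      _ < ∞ := ENNReal.mul_lt_top measure_ball_lt_top
          (ENNReal.mul_lt_top measure_ball_lt_top hg.energy_lt_top)

theorem tsum_ofReal_pow_div_factorial {κ : ℝ} (hκ : 0 ≤ κ) :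
    ∑' n : ℕ, ENNReal.ofReal (κ ^ n / n.factorial) = ENNReal.ofReal (Real.exp κ) := by
  rw [← ENNReal.ofReal_tsum_of_nonneg (fun n => by positivity)
    (Real.summable_pow_div_factorial κ), Real.exp_eq_exp_ℝ, NormedSpace.exp_eq_tsum_div]

/-- If `|t|L ≤ κ` on `S`, then the maximal function, multiplied by the function with Fourier
transform `q 1_{|η|<1/4}`, is controlled by the maximal functions of the Taylor coefficients. -/
theorem maxEnergy_le_tsum_taylor {q g : Space d → ℂ} {S : Set ℝ} {κ : ℝ} {c K : ℝ≥0∞}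
    {μ : Measure (Space d)} (hS : SlowSymbol d α a b L) (hg : Band a b g)
    (hq : Measurable q) (hq1 : ∀ η, ‖q η‖ ≤ 1) (hκ0 : 0 ≤ κ) (hκ : ∀ t ∈ S, |t| * L ≤ κ)
    (hc : ∀ᵐ x ∂μ, c ≤ ‖∫ η in Metric.ball (0 : Space d) (1 / 4),
      Complex.exp (Complex.I * (inner ℝ x η : ℝ)) * q η‖ₑ)
    (hK : MaxBound α S μ (a - 1 / 4) (b + 1 / 4) K) :
    c ^ 2 * maxEnergy α S μ g ≤ ENNReal.ofReal (Real.exp κ) *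
      ∑' n : ℕ, ENNReal.ofReal (κ ^ n / n.factorial) * (K * energy (taylorCoeff α L q g n)) := by
  set h : ℕ → Space d → ℂ := taylorCoeff α L q g with hh
  have hb : ∀ n, Band (a - 1 / 4) (b + 1 / 4) (h n) := fun n => hg.taylorCoeff hS hq hq1 n
  set w : ℕ → ℝ≥0∞ := fun n => ENNReal.ofReal (κ ^ n / n.factorial) with hw
  set M : ℕ → Space d → ℝ≥0∞ := fun n x => ⨆ t ∈ S, ‖evolution α t (h n) x‖ₑ with hM
  have hMm : ∀ n, Measurable (M n) := fun n => measurable_maximal (hb n).integrable α S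
  have hgm := measurable_maximal hg.integrable α S
  have pt : ∀ᵐ x ∂μ, c ^ 2 * (⨆ t ∈ S, ‖evolution α t g x‖ₑ) ^ 2 ≤
      ENNReal.ofReal (Real.exp κ) * ∑' n, w n * M n x ^ 2 := by
    filter_upwards [hc] with x hx
    rw [← tsum_ofReal_pow_div_factorial hκ0, ← mul_pow]
    refine le_trans (pow_le_pow_left₀ (by positivity) ?_ 2) (sq_tsum_mul_le w fun n => M n x)
    rw [ENNReal.mul_iSup]
    refine iSup_le fun t => ?_
    rw [ENNReal.mul_iSup]
    refine iSup_le fun ht => ?_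
    refine (mul_le_mul_left hx _).trans ?_
    rw [← enorm_mul, ← (hasSum_taylor hS hg hq hq1 t x).tsum_eq]
    refine enorm_tsum_le_tsum_enorm.trans (ENNReal.tsum_le_tsum fun n => ?_)
    rw [enorm_mul]
    refine mul_le_mul' ?_ (le_biSup (fun t => ‖evolution α t (h n) x‖ₑ) ht)
    rw [← ofReal_norm]
    refine ENNReal.ofReal_le_ofReal ?_
    have : ‖(Complex.I * ((t * L : ℝ) : ℂ)) ^ n / (n.factorial : ℂ)‖ =
        (|t| * L) ^ n / n.factorial := by
      rw [norm_div, norm_pow, norm_mul, Complex.norm_I, one_mul, Complex.norm_real,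
        Real.norm_eq_abs, abs_mul, abs_of_pos hS.1]
      simp
    rw [this]
    have := hκ t ht
    have := hS.1
    gcongr
  calc c ^ 2 * maxEnergy α S μ g
      = ∫⁻ x, c ^ 2 * (⨆ t ∈ S, ‖evolution α t g x‖ₑ) ^ 2 ∂μ :=
        (lintegral_const_mul _ (hgm.pow_const 2)).symm
    _ ≤ ∫⁻ x, ENNReal.ofReal (Real.exp κ) * ∑' n, w n * M n x ^ 2 ∂μ := lintegral_mono_ae pt
    _ = ENNReal.ofReal (Real.exp κ) * ∑' n, w n * maxEnergy α S μ (h n) := by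
        rw [lintegral_const_mul' _ _ ENNReal.ofReal_ne_top, lintegral_tsum fun n =>
          (((hMm n).pow_const 2).const_mul _).aemeasurable]
        congr 2
        funext n
        exact lintegral_const_mul _ ((hMm n).pow_const 2)
    _ ≤ _ := by
        gcongr with n
        exact hK _ (hb n)

/-- Averaging the localized estimate over a family of localizations. The hypothesis on `D`
expresses the almost orthogonality of the localized pieces. -/
theorem lintegral_maxEnergy_le {P : Type*} [MeasurableSpace P] (ν : Measure P) [SFinite ν]
    {q g : P → Space d → ℂ} {g₀ : Space d → ℂ} {S : Set ℝ} {κ : ℝ} {c K D : ℝ≥0∞}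
    {μ : P → Measure (Space d)} (hS : SlowSymbol d α a b L)
    (hg₀ : Measurable g₀) (hg : ∀ p, Band a b (g p))
    (hgm : Measurable fun p : P × Space d => g p.1 p.2)
    (hq : Measurable fun p : P × Space d => q p.1 p.2) (hq1 : ∀ p η, ‖q p η‖ ≤ 1)
    (hκ0 : 0 ≤ κ) (hκ : ∀ t ∈ S, |t| * L ≤ κ)
    (hc : ∀ p, ∀ᵐ x ∂μ p, c ≤ ‖∫ η in Metric.ball (0 : Space d) (1 / 4),
      Complex.exp (Complex.I * (inner ℝ x η : ℝ)) * q p η‖ₑ)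
    (hK : ∀ p, MaxBound α S (μ p) (a - 1 / 4) (b + 1 / 4) K)
    (hD : ∀ n ζ, ∫⁻ p, ‖taylorCoeff α L (q p) (g p) n ζ‖ₑ ^ 2 ∂ν ≤
      D * ∫⁻ η in Metric.ball (0 : Space d) (1 / 4), ‖g₀ (ζ - η)‖ₑ ^ 2) :
    ∫⁻ p, c ^ 2 * maxEnergy α S (μ p) (g p) ∂ν ≤
      ENNReal.ofReal (Real.exp κ) ^ 2 * K * D * volume (Metric.ball (0 : Space d) (1 / 4)) *
        energy g₀ := by
  set w : ℕ → ℝ≥0∞ := fun n => ENNReal.ofReal (κ ^ n / n.factorial) with hw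
  set V := volume (Metric.ball (0 : Space d) (1 / 4)) with hV
  have hm : ∀ n, Measurable fun p : P × Space d => ‖taylorCoeff α L (q p.1) (g p.1) n p.2‖ₑ ^ 2 :=
    fun n => (measurable_taylorCoeff_prod hq hgm α L n).enorm.pow_const 2
  have hmE : ∀ n, Measurable fun p => energy (taylorCoeff α L (q p) (g p) n) := fun n =>
    (hm n).lintegral_prod_right'
  have hE : ∀ n, ∫⁻ p, energy (taylorCoeff α L (q p) (g p) n) ∂ν ≤ D * (V * energy g₀) := by
    intro n
    have hu : Measurable fun ξ => ‖g₀ ξ‖ₑ ^ 2 := hg₀.enorm.pow_const 2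
    unfold energy
    rw [lintegral_lintegral_swap (hm n).aemeasurable, ← lintegral_lintegral_ball_sub hu]
    rw [← lintegral_const_mul]
    · exact lintegral_mono fun ζ => hD n ζ
    · exact Measurable.lintegral_prod_right' (f := fun p : Space d × Space d =>
        ‖g₀ (p.1 - p.2)‖ₑ ^ 2) (hu.comp (measurable_fst.sub measurable_snd))
  calc ∫⁻ p, c ^ 2 * maxEnergy α S (μ p) (g p) ∂ν
      ≤ ∫⁻ p, ENNReal.ofReal (Real.exp κ) *
          ∑' n : ℕ, w n * (K * energy (taylorCoeff α L (q p) (g p) n)) ∂ν := by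
        refine lintegral_mono fun p => ?_
        have hqp : Measurable (q p) := hq.comp (measurable_const.prodMk measurable_id)
        exact maxEnergy_le_tsum_taylor hS (hg p) hqp (hq1 p) hκ0 hκ (hc p) (hK p)
    _ = ENNReal.ofReal (Real.exp κ) *
          ∑' n : ℕ, w n * (K * ∫⁻ p, energy (taylorCoeff α L (q p) (g p) n) ∂ν) := by
        rw [lintegral_const_mul' _ _ ENNReal.ofReal_ne_top, lintegral_tsum fun n =>
          (((hmE n).const_mul K).const_mul _).aemeasurable]
        congr 2
        funext n
        rw [lintegral_const_mul _ ((hmE n).const_mul K), lintegral_const_mul _ (hmE n)]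
    _ ≤ ENNReal.ofReal (Real.exp κ) * ∑' n : ℕ, w n * (K * (D * (V * energy g₀))) := by
        gcongr with n
        exact hE n
    _ = _ := by
        rw [ENNReal.tsum_mul_right, tsum_ofReal_pow_div_factorial hκ0]
        ring

end Averages

/-! ### Localization in space -/

section SpaceLocalization

variable {d : ℕ} {α a b L : ℝ}

/-- On the unit ball the localizing function is bounded from below. -/
theorem half_volume_le_enorm_integral (y : Space d) (hy : ‖y‖ ≤ 1) :
    volume (Metric.ball (0 : Space d) (1 / 4)) / 2 ≤
      ‖∫ η in Metric.ball (0 : Space d) (1 / 4), Complex.exp (Complex.I * (inner ℝ y η : ℝ))‖ₑ := by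
  have hfin : IsFiniteMeasure (volume.restrict (Metric.ball (0 : Space d) (1 / 4))) :=
    ⟨by simpa using measure_ball_lt_top⟩
  have h := half_le_norm_integral_phase (volume.restrict (Metric.ball (0 : Space d) (1 / 4)))
    (φ := fun η => inner ℝ y η) (by fun_prop) (by
      filter_upwards [ae_restrict_mem Metric.isOpen_ball.measurableSet] with η hη
      have h1 : ‖η‖ < 1 / 4 := by simpa using hη
      refine (abs_real_inner_le_norm y η).trans ?_
      nlinarith [norm_nonneg y, norm_nonneg η])
  have h2 := ENNReal.ofReal_le_ofReal h
  rw [ofReal_norm, ENNReal.ofReal_div_of_pos (by norm_num), ofReal_measureReal] at h2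
  simpa using h2

/-- Bounds on all unit balls imply the same bound on the whole space. -/
theorem exists_maxBound_of_balls (d : ℕ) {κ : ℝ} (hκ0 : 0 ≤ κ) :
    ∃ C : ℝ≥0∞, C ≠ ∞ ∧ ∀ (α a b L : ℝ) (S : Set ℝ) (μ : Measure (Space d)) (K : ℝ≥0∞),
      SFinite μ → SlowSymbol d α a b L → (∀ t ∈ S, |t| * L ≤ κ) →
      (∀ x₀, MaxBound α S (μ.restrict (Metric.ball x₀ 1)) (a - 1 / 4) (b + 1 / 4) K) →
      MaxBound α S μ a b (C * K) := by
  set V := volume (Metric.ball (0 : Space d) (1 / 4)) with hV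
  have hV0 : V ≠ 0 := (Metric.measure_ball_pos _ _ (by norm_num)).ne'
  have hVt : V ≠ ∞ := measure_ball_lt_top.ne
  have hπ : 0 < 2 * Real.pi := by positivity
  set W := volume (Metric.ball (0 : Space d) ((2 * Real.pi)⁻¹)) with hW
  have hW0 : W ≠ 0 := (Metric.measure_ball_pos _ _ (by positivity)).ne'
  have hWt : W ≠ ∞ := measure_ball_lt_top.ne
  set E := ENNReal.ofReal (Real.exp κ) ^ 2 * V with hE
  have hEt : E ≠ ∞ := ENNReal.mul_ne_top (ENNReal.pow_ne_top ENNReal.ofReal_ne_top) hVt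
  set Q := (V / 2) ^ 2 * W with hQ
  have hQ0 : Q ≠ 0 := mul_ne_zero (pow_ne_zero _ (ENNReal.div_ne_zero.2 ⟨hV0, by norm_num⟩)) hW0
  have hQt : Q ≠ ∞ :=
    ENNReal.mul_ne_top (ENNReal.pow_ne_top (ENNReal.div_ne_top hVt (by norm_num))) hWt
  refine ⟨Q⁻¹ * E, ENNReal.mul_ne_top (ENNReal.inv_ne_top.2 hQ0) hEt, ?_⟩
  intro α a b L S μ K hμ hS hκ hK g hg
  set F : Space d → ℝ≥0∞ := fun x => (⨆ t ∈ S, ‖evolution α t g x‖ₑ) ^ 2 with hF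
  have hFm : Measurable F := (measurable_maximal hg.integrable α S).pow_const 2
  -- the localization to the ball around `2πz` modulates the Fourier transform by `z`
  set q : Space d → Space d → ℂ := fun z η =>
    Complex.exp (Complex.I * ((-(2 * Real.pi * inner ℝ z η) : ℝ) : ℂ)) with hq
  have hqm : Measurable fun p : Space d × Space d => q p.1 p.2 := by fun_prop
  have main := lintegral_maxEnergy_le (volume : Measure (Space d)) (q := q) (g := fun _ => g)
    (g₀ := g) (S := S) (κ := κ) (c := V / 2) (K := K) (D := 1)
    (μ := fun z => μ.restrict (Metric.ball ((2 * Real.pi) • z) 1)) hS hg.measurable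
    (fun _ => hg) (hg.measurable.comp measurable_snd) hqm (fun z η => (norm_phase _).le) hκ0 hκ
    ?_ (fun z => hK _) ?_
  · have hswap : ∫⁻ z, maxEnergy α S (μ.restrict (Metric.ball ((2 * Real.pi) • z) 1)) g =
        W * maxEnergy α S μ g := by
      set A : Set (Space d × Space d) := {p | dist p.2 ((2 * Real.pi) • p.1) < 1} with hA
      have hAm : MeasurableSet A := measurableSet_lt (by fun_prop) measurable_const
      have e1 : ∀ z, maxEnergy α S (μ.restrict (Metric.ball ((2 * Real.pi) • z) 1)) g =
          ∫⁻ x, A.indicator (fun p => F p.2) (z, x) ∂μ := by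
        intro z
        rw [maxEnergy, ← lintegral_indicator Metric.isOpen_ball.measurableSet]
        rfl
      have e2 : ∀ x, ∫⁻ z, A.indicator (fun p => F p.2) (z, x) = W * F x := by
        intro x
        have : ∀ z, A.indicator (fun p => F p.2) (z, x) =
            (Metric.ball ((2 * Real.pi)⁻¹ • x) ((2 * Real.pi)⁻¹)).indicator (fun _ => F x) z := by
          intro z
          have hiff : (z, x) ∈ A ↔ z ∈ Metric.ball ((2 * Real.pi)⁻¹ • x) ((2 * Real.pi)⁻¹) := by
            have e3 : x - (2 * Real.pi) • z = -((2 * Real.pi) • (z - (2 * Real.pi)⁻¹ • x)) := by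
              rw [smul_sub, smul_inv_smul₀ hπ.ne', neg_sub]
            simp only [hA, mem_ofPred_eq, Metric.mem_ball, dist_eq_norm, e3, norm_neg, norm_smul,
              Real.norm_eq_abs, abs_of_pos hπ]
            rw [← one_div, lt_div_iff₀' hπ]
          by_cases h : (z, x) ∈ A
          · rw [indicator_of_mem h, indicator_of_mem (hiff.1 h)]
          · rw [indicator_of_notMem h, indicator_of_notMem (fun h' => h (hiff.2 h'))]
        simp only [this]
        rw [lintegral_indicator Metric.isOpen_ball.measurableSet, setLIntegral_const, mul_comm,
          hW, Measure.addHaar_ball_center]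
      simp only [e1]
      rw [lintegral_lintegral_swap]
      · simp only [e2]
        exact lintegral_const_mul _ hFm
      · exact ((hFm.comp measurable_snd).indicator hAm).aemeasurable
    rw [lintegral_const_mul' _ _ (ENNReal.pow_ne_top (ENNReal.div_ne_top hVt (by norm_num))),
      hswap, ← mul_assoc, mul_one] at main
    calc maxEnergy α S μ g = Q⁻¹ * (Q * maxEnergy α S μ g) := by
          rw [← mul_assoc, ENNReal.inv_mul_cancel hQ0 hQt, one_mul]
      _ ≤ Q⁻¹ * (ENNReal.ofReal (Real.exp κ) ^ 2 * K * V * energy g) := by gcongr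
      _ = Q⁻¹ * E * K * energy g := by rw [hE]; ring
  · intro z
    filter_upwards [ae_restrict_mem Metric.isOpen_ball.measurableSet] with x hx
    have h := half_volume_le_enorm_integral (x - (2 * Real.pi) • z)
      (by simpa [dist_eq_norm] using (Metric.mem_ball.1 hx).le)
    refine h.trans_eq (congrArg _ (integral_congr_ae (.of_forall fun η => ?_)))
    simp only [hq, ← Complex.exp_add, ← mul_add, ← Complex.ofReal_add]
    congr 3
    rw [inner_sub_left, real_inner_smul_left]
    ring
  · -- Plancherel's identity in the centre of the localization
    intro n ζ
    set H : Space d → ℂ := (Metric.ball (0 : Space d) (1 / 4)).indicator fun η =>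
      g (ζ - η) * (((‖ζ - η‖ ^ α - ‖ζ‖ ^ α) / L : ℝ) : ℂ) ^ n with hH
    have hHm : Measurable H := by
      have := measurable_taylor_integrand (measurable_const (a := (1 : ℂ))) hg.measurable α L n
      have h2 := this.comp (measurable_const (a := ζ) |>.prodMk measurable_id)
      simp only [Function.comp_def, one_mul, id] at h2
      exact h2.indicator Metric.isOpen_ball.measurableSet
    have hHle : ∀ η, ‖H η‖ ≤ ‖(Metric.ball (0 : Space d) (1 / 4)).indicator
        (fun η => g (ζ - η)) η‖ := by
      intro η
      by_cases h : η ∈ Metric.ball (0 : Space d) (1 / 4)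
      · rw [hH, indicator_of_mem h, indicator_of_mem h]
        have := norm_taylor_integrand_le hS hg (q := fun _ => 1) (by simp) n ζ η (by simpa using h)
        simpa only [one_mul] using this
      · rw [hH, indicator_of_notMem h, indicator_of_notMem h]
    have hG1 : Integrable fun η => g (ζ - η) := hg.integrable.comp_sub_left ζ
    have hG2 : MemLp (fun η => g (ζ - η)) 2 :=
      hg.memLp.comp_measurePreserving (Measure.measurePreserving_sub_left volume ζ)
    have hH1 : Integrable H := (hG1.indicator Metric.isOpen_ball.measurableSet).mono
      hHm.aestronglyMeasurable (.of_forall hHle)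
    have hH2 : MemLp H 2 := (hG2.indicator Metric.isOpen_ball.measurableSet).mono
      hHm.aestronglyMeasurable (.of_forall hHle)
    have hT : ∀ z, taylorCoeff α L (q z) g n ζ = 𝓕 H z := by
      intro z
      rw [Real.fourier_eq', taylorCoeff, ← integral_indicator Metric.isOpen_ball.measurableSet]
      refine integral_congr_ae (.of_forall fun η => ?_)
      by_cases h : η ∈ Metric.ball (0 : Space d) (1 / 4)
      · simp only [hH, indicator_of_mem h, hq, smul_eq_mul]
        rw [mul_assoc, mul_comm Complex.I, real_inner_comm]
        congr 4
        ring
      · simp only [hH, indicator_of_notMem h, smul_zero]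
    simp only [hT]
    rw [lintegral_fourier_sq hH1 hH2, one_mul,
      ← lintegral_indicator Metric.isOpen_ball.measurableSet]
    refine lintegral_mono fun η => ?_
    refine (pow_le_pow_left₀ (by positivity) (enorm_le_iff_norm_le.2 (hHle η)) 2).trans_eq ?_
    by_cases h : η ∈ Metric.ball (0 : Space d) (1 / 4)
    · rw [indicator_of_mem h, indicator_of_mem h]
    · rw [indicator_of_notMem h, indicator_of_notMem h]; simp

end SpaceLocalization

/-! ### Local smoothing -/

section LocalSmoothing

/-- The Fourier transform of an interval of length one is at least `1/2` at the frequencies at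
which the phase is at most `1`. -/
theorem half_le_norm_fourier_interval {τ : ℝ} (hτ : |τ| ≤ (2 * Real.pi)⁻¹) :
    1 / 2 ≤ ‖∫ σ in Icc (-(1 / 2) : ℝ) (1 / 2),
      Complex.exp (Complex.I * ((-(2 * Real.pi * τ * σ) : ℝ) : ℂ))‖ := by
  have hπ : 0 < 2 * Real.pi := by positivity
  have h := half_le_norm_integral_phase (volume.restrict (Icc (-(1 / 2) : ℝ) (1 / 2)))
    (φ := fun σ => -(2 * Real.pi * τ * σ)) (by fun_prop) (by
      filter_upwards [ae_restrict_mem measurableSet_Icc] with σ hσ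
      have h1 : |σ| ≤ 1 := abs_le.2 ⟨by linarith [hσ.1], by linarith [hσ.2]⟩
      rw [abs_neg, abs_mul, abs_mul, abs_of_pos hπ]
      have h2 : 2 * Real.pi * |τ| ≤ 1 := by
        calc 2 * Real.pi * |τ| ≤ 2 * Real.pi * (2 * Real.pi)⁻¹ := by gcongr
          _ = 1 := mul_inv_cancel₀ hπ.ne'
      nlinarith [abs_nonneg σ, abs_nonneg τ])
  have hv : (volume.restrict (Icc (-(1 / 2) : ℝ) (1 / 2))).real univ = 1 := by
    simp [Measure.real]; norm_num
  rwa [hv] at h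

/-- If the level sets `{|p - σ| ≤ 1/2}` have measure at most `m` on the support of `h`, then the
oscillatory integral with phase `τ p` gains the factor `m` in the square mean over
`|τ| ≲ 1`. This is Plancherel's identity for the push-forward of `h` under `p`, smoothed at
scale one. -/
theorem lintegral_oscillatory_sq_le {X : Type*} [MeasurableSpace X] (ν : Measure X)
    [IsFiniteMeasure ν] {p : X → ℝ} (hp : Measurable p) {h : X → ℂ} (hh : Measurable h)
    (hh2 : ∫⁻ x, ‖h x‖ₑ ^ 2 ∂ν < ∞) {m : ℝ≥0∞} (hmt : m ≠ ∞)
    (hm : ∀ σ, ν {x | h x ≠ 0 ∧ |σ - p x| ≤ 1 / 2} ≤ m) :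
    ∫⁻ τ in Icc (-(2 * Real.pi)⁻¹) ((2 * Real.pi)⁻¹),
        ‖∫ x, Complex.exp (Complex.I * ((-(2 * Real.pi * τ * p x) : ℝ) : ℂ)) * h x ∂ν‖ₑ ^ 2 ≤
      4 * m * ∫⁻ x, ‖h x‖ₑ ^ 2 ∂ν := by
  have hL2 : MemLp h 2 ν := by
    refine ⟨hh.aestronglyMeasurable, ?_⟩
    rw [lintegral_enorm_sq_eq_eLpNorm_sq] at hh2
    exact (ENNReal.pow_lt_top_iff.1 hh2).resolve_right (by norm_num)
  have hL1 : Integrable h ν := hL2.integrable (by norm_num)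
  set A : Set (ℝ × X) := {z | |z.1 - p z.2| ≤ 1 / 2} with hA
  have hAm : MeasurableSet A := measurableSet_le (by fun_prop) measurable_const
  set k : ℝ × X → ℂ := A.indicator fun z => h z.2 with hk
  have hkm : Measurable k := (hh.comp measurable_snd).indicator hAm
  have hAx : ∀ x σ, (σ, x) ∈ A ↔ σ ∈ Icc (p x - 1 / 2) (p x + 1 / 2) := by
    intro x σ
    simp only [hA, mem_ofPred_eq, abs_le, mem_Icc]
    constructor <;> rintro ⟨h1, h2⟩ <;> constructor <;> linarith
  have hvol : ∀ (x : X) (y : ℝ≥0∞), ∫⁻ σ, A.indicator (fun _ => y) (σ, x) = y := by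
    intro x y
    have : ∀ σ, A.indicator (fun _ => y) (σ, x) =
        (Icc (p x - 1 / 2) (p x + 1 / 2)).indicator (fun _ => y) σ := by
      intro σ
      by_cases hs : (σ, x) ∈ A
      · rw [indicator_of_mem hs, indicator_of_mem ((hAx x σ).1 hs)]
      · rw [indicator_of_notMem hs, indicator_of_notMem (fun h' => hs ((hAx x σ).2 h'))]
    simp only [this]
    rw [lintegral_indicator measurableSet_Icc, setLIntegral_const, Real.volume_Icc]
    norm_num
  have hkint : Integrable k (volume.prod ν) := by
    refine ⟨hkm.aestronglyMeasurable, ?_⟩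
    rw [HasFiniteIntegral, lintegral_prod_symm _ hkm.enorm.aemeasurable]
    have : ∀ x, ∫⁻ σ, ‖k (σ, x)‖ₑ = ‖h x‖ₑ := by
      intro x
      rw [← hvol x ‖h x‖ₑ]
      refine lintegral_congr fun σ => ?_
      by_cases hs : (σ, x) ∈ A
      · rw [hk, indicator_of_mem hs, indicator_of_mem hs]
      · rw [hk, indicator_of_notMem hs, indicator_of_notMem hs, enorm_zero]
    simp only [this]
    exact hL1.2
  set F : ℝ → ℂ := fun σ => ∫ x, k (σ, x) ∂ν with hF
  have hF1 : Integrable F := hkint.integral_prod_left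
  have hFsq : ∀ σ, ‖F σ‖ₑ ^ 2 ≤ m * ∫⁻ x, A.indicator (fun z => ‖h z.2‖ₑ ^ 2) (σ, x) ∂ν := by
    intro σ
    set B : Set X := {x | h x ≠ 0 ∧ |σ - p x| ≤ 1 / 2} with hB
    have hBm : MeasurableSet B := by
      have h1 : Measurable fun x => |σ - p x| := by fun_prop
      exact (hh (measurableSet_singleton 0).compl).inter (measurableSet_le h1 measurable_const)
    have h1 : ‖F σ‖ₑ ≤ ∫⁻ x in B, ‖h x‖ₑ ∂ν := by
      refine (enorm_integral_le_lintegral_enorm _).trans ?_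
      rw [← lintegral_indicator hBm]
      refine lintegral_mono fun x => ?_
      by_cases hs : (σ, x) ∈ A
      · rw [hk, indicator_of_mem hs]
        by_cases h0 : h x = 0
        · simp [h0]
        · rw [indicator_of_mem (show x ∈ B from ⟨h0, hs⟩)]
      · rw [hk, indicator_of_notMem hs]; simp
    calc ‖F σ‖ₑ ^ 2 ≤ (∫⁻ x in B, ‖h x‖ₑ ∂ν) ^ 2 := pow_le_pow_left₀ (by positivity) h1 2
      _ ≤ (ν.restrict B) univ * ∫⁻ x in B, ‖h x‖ₑ ^ 2 ∂ν :=
        sq_lintegral_le _ hh.enorm.aemeasurable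
      _ ≤ m * ∫⁻ x, A.indicator (fun z => ‖h z.2‖ₑ ^ 2) (σ, x) ∂ν := by
        refine mul_le_mul' (by rw [Measure.restrict_apply_univ]; exact hm σ) ?_
        rw [← lintegral_indicator hBm]
        refine lintegral_mono fun x => ?_
        by_cases hs : x ∈ B
        · rw [indicator_of_mem hs, indicator_of_mem (show (σ, x) ∈ A from hs.2)]
        · rw [indicator_of_notMem hs]; exact zero_le
  have hAI : Measurable (A.indicator fun z : ℝ × X => ‖h z.2‖ₑ ^ 2) :=
    ((hh.comp measurable_snd).enorm.pow_const 2).indicator hAm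
  have hFtot : ∫⁻ σ, ‖F σ‖ₑ ^ 2 ≤ m * ∫⁻ x, ‖h x‖ₑ ^ 2 ∂ν := by
    calc ∫⁻ σ, ‖F σ‖ₑ ^ 2
        ≤ ∫⁻ σ, m * ∫⁻ x, A.indicator (fun z => ‖h z.2‖ₑ ^ 2) (σ, x) ∂ν :=
          lintegral_mono hFsq
      _ = m * ∫⁻ x, (∫⁻ σ, A.indicator (fun z => ‖h z.2‖ₑ ^ 2) (σ, x)) ∂ν := by
          rw [lintegral_const_mul' _ _ hmt, lintegral_lintegral_swap]
          exact hAI.aemeasurable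
      _ = m * ∫⁻ x, ‖h x‖ₑ ^ 2 ∂ν := by
          congr 1
          refine lintegral_congr fun x => ?_
          rw [← hvol x (‖h x‖ₑ ^ 2)]
          refine lintegral_congr fun σ => ?_
          by_cases hs : (σ, x) ∈ A
          · rw [indicator_of_mem hs, indicator_of_mem hs]
          · rw [indicator_of_notMem hs, indicator_of_notMem hs]
  have hF2 : MemLp F 2 := by
    refine ⟨hF1.aestronglyMeasurable, ?_⟩
    have : ∫⁻ σ, ‖F σ‖ₑ ^ 2 < ∞ := hFtot.trans_lt (ENNReal.mul_lt_top hmt.lt_top hh2)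
    rw [lintegral_enorm_sq_eq_eLpNorm_sq] at this
    exact (ENNReal.pow_lt_top_iff.1 this).resolve_right (by norm_num)
  set v : ℝ → ℂ := fun τ => ∫ σ in Icc (-(1 / 2) : ℝ) (1 / 2),
      Complex.exp (Complex.I * ((-(2 * Real.pi * τ * σ) : ℝ) : ℂ)) with hv
  have hFour : ∀ τ, 𝓕 F τ =
      v τ * ∫ x, Complex.exp (Complex.I * ((-(2 * Real.pi * τ * p x) : ℝ) : ℂ)) * h x ∂ν := by
    intro τ
    set E : ℝ → ℂ := fun σ => Complex.exp (Complex.I * ((-(2 * Real.pi * τ * σ) : ℝ) : ℂ)) with hE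
    have hEm : Measurable E := by fun_prop
    have e1 : 𝓕 F τ = ∫ σ, ∫ x, E σ * k (σ, x) ∂ν := by
      rw [Real.fourier_real_eq_integral_exp_smul]
      refine integral_congr_ae (.of_forall fun σ => ?_)
      simp only [hF, smul_eq_mul]
      rw [integral_const_mul, hE]
      congr 2
      push_cast
      ring
    have e2 : Integrable (fun z : ℝ × X => E z.1 * k z) (volume.prod ν) :=
      hkint.bdd_mul (c := 1) (hEm.comp measurable_fst).aestronglyMeasurable
        (.of_forall fun z => (norm_phase _).le)
    rw [e1, integral_integral_swap e2, ← integral_const_mul]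
    refine integral_congr_ae (.of_forall fun x => ?_)
    simp only
    have e3 : ∀ σ, E σ * k (σ, x) =
        (Icc (p x - 1 / 2) (p x + 1 / 2)).indicator (fun σ => E σ * h x) σ := by
      intro σ
      by_cases hs : (σ, x) ∈ A
      · rw [hk, indicator_of_mem hs, indicator_of_mem ((hAx x σ).1 hs)]
      · rw [hk, indicator_of_notMem hs, indicator_of_notMem (fun h' => hs ((hAx x σ).2 h')),
          mul_zero]
    simp only [e3]
    rw [← integral_add_right_eq_self _ (p x)]
    have e4 : ∀ σ, (Icc (p x - 1 / 2) (p x + 1 / 2)).indicator (fun σ => E σ * h x) (σ + p x) =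
        (Icc (-(1 / 2) : ℝ) (1 / 2)).indicator (fun σ => E σ * (E (p x) * h x)) σ := by
      intro σ
      have hiff : σ + p x ∈ Icc (p x - 1 / 2) (p x + 1 / 2) ↔ σ ∈ Icc (-(1 / 2) : ℝ) (1 / 2) := by
        simp only [mem_Icc]
        constructor <;> rintro ⟨h1, h2⟩ <;> constructor <;> linarith
      by_cases hs : σ ∈ Icc (-(1 / 2) : ℝ) (1 / 2)
      · rw [indicator_of_mem hs, indicator_of_mem (hiff.2 hs), ← mul_assoc]
        congr 1
        simp only [hE, ← Complex.exp_add]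
        congr 1
        push_cast
        ring
      · rw [indicator_of_notMem hs, indicator_of_notMem (fun h' => hs (hiff.1 h'))]
    simp only [e4]
    rw [integral_indicator measurableSet_Icc, integral_mul_const]
  have hlow : ∀ τ ∈ Icc (-(2 * Real.pi)⁻¹) ((2 * Real.pi)⁻¹),
      ‖∫ x, Complex.exp (Complex.I * ((-(2 * Real.pi * τ * p x) : ℝ) : ℂ)) * h x ∂ν‖ₑ ^ 2 ≤
        4 * ‖𝓕 F τ‖ₑ ^ 2 := by
    intro τ hτ
    have h1 : (1 / 2 : ℝ) ≤ ‖v τ‖ := half_le_norm_fourier_interval (abs_le.2 hτ)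
    set Z := ∫ x, Complex.exp (Complex.I * ((-(2 * Real.pi * τ * p x) : ℝ) : ℂ)) * h x ∂ν with hZ
    have h2 : ‖Z‖ ≤ ‖(2 : ℂ) * 𝓕 F τ‖ := by
      rw [hFour τ, norm_mul, norm_mul, Complex.norm_ofNat]
      nlinarith [norm_nonneg Z]
    calc ‖Z‖ₑ ^ 2 ≤ ‖(2 : ℂ) * 𝓕 F τ‖ₑ ^ 2 :=
          pow_le_pow_left₀ (by positivity) (enorm_le_iff_norm_le.2 h2) 2
      _ = 4 * ‖𝓕 F τ‖ₑ ^ 2 := by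
          rw [enorm_mul, mul_pow]
          congr 1
          rw [← ofReal_norm]
          norm_num
  calc _ ≤ ∫⁻ τ in Icc (-(2 * Real.pi)⁻¹) ((2 * Real.pi)⁻¹), 4 * ‖𝓕 F τ‖ₑ ^ 2 :=
        setLIntegral_mono' measurableSet_Icc hlow
    _ ≤ ∫⁻ τ, 4 * ‖𝓕 F τ‖ₑ ^ 2 := setLIntegral_le_lintegral _ _
    _ = 4 * ∫⁻ σ, ‖F σ‖ₑ ^ 2 := by
        rw [lintegral_const_mul' _ _ (by norm_num), lintegral_fourier_sq hF1 hF2]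
    _ ≤ 4 * (m * ∫⁻ x, ‖h x‖ₑ ^ 2 ∂ν) := by gcongr
    _ = _ := by ring

end LocalSmoothing

section Shell

variable {d : ℕ}

/-- Moving `v` in a nearby direction by `s` increases its norm by at least `s / 2`. -/
theorem norm_add_half_le_norm_add {v ζ : Space d} (hv : 1 ≤ ‖v‖) (hζ : ‖ζ - v‖ < 1 / 4) {s : ℝ}
    (hs : 0 ≤ s) : ‖v‖ + s / 2 ≤ ‖v + s • (‖ζ‖⁻¹ • ζ)‖ := by
  have hζv : ‖ζ‖ ≤ ‖v‖ + 1 / 4 := by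
    have := norm_le_norm_sub_add ζ v
    linarith
  have hζ0 : 0 < ‖ζ‖ := by
    have := norm_sub_norm_le v (v - ζ)
    rw [sub_sub_cancel, norm_sub_rev v ζ] at this
    linarith
  have h1 : ‖v‖ ^ 2 - ‖v‖ / 4 ≤ inner ℝ ζ v := by
    have e : inner ℝ ζ v = ‖v‖ ^ 2 + inner ℝ (ζ - v) v := by
      rw [inner_sub_left, real_inner_self_eq_norm_sq]; ring
    have := (abs_le.1 (abs_real_inner_le_norm (ζ - v) v)).1
    rw [e]
    nlinarith [norm_nonneg v]
  have h2 : ‖v‖ / 2 ≤ ‖ζ‖⁻¹ * inner ℝ ζ v := by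
    rw [← div_eq_inv_mul, le_div_iff₀ hζ0]
    nlinarith
  have h3 : inner ℝ (v + s • (‖ζ‖⁻¹ • ζ)) v = ‖v‖ ^ 2 + s * (‖ζ‖⁻¹ * inner ℝ ζ v) := by
    rw [inner_add_left, real_inner_smul_left, real_inner_smul_left, real_inner_self_eq_norm_sq]
  have h4 := real_inner_le_norm (v + s • (‖ζ‖⁻¹ • ζ)) v
  have h5 : (‖v‖ + s / 2) * ‖v‖ ≤ ‖v + s • (‖ζ‖⁻¹ • ζ)‖ * ‖v‖ := by
    refine le_trans ?_ h4
    rw [h3]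
    nlinarith
  exact le_of_mul_le_mul_right h5 (by linarith)

/-- Convexity of `r ↦ r^α` for `α ≥ 1`. -/
theorem mul_sub_le_rpow_sub_rpow {α m r₁ r₂ : ℝ} (hα : 1 ≤ α) (hm : 0 < m) (h1 : m ≤ r₁)
    (h12 : r₁ ≤ r₂) : α * m ^ (α - 1) * (r₂ - r₁) ≤ r₂ ^ α - r₁ ^ α := by
  have hr : 0 < r₁ := hm.trans_le h1
  have h := one_add_mul_self_le_rpow_one_add (s := (r₂ - r₁) / r₁)
    (by have := div_nonneg (sub_nonneg.2 h12) hr.le; linarith) hα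
  have e1 : 1 + (r₂ - r₁) / r₁ = r₂ / r₁ := by field_simp; ring
  rw [e1, Real.div_rpow (hr.le.trans h12) hr.le, le_div_iff₀ (by positivity)] at h
  have e2 : r₁ ^ α = r₁ ^ (α - 1) * r₁ := by
    rw [← Real.rpow_add_one hr.ne']; ring_nf
  have h3 : m ^ (α - 1) ≤ r₁ ^ (α - 1) := Real.rpow_le_rpow hm.le h1 (by linarith)
  have h4 : (1 + α * ((r₂ - r₁) / r₁)) * r₁ ^ α = r₁ ^ α + α * r₁ ^ (α - 1) * (r₂ - r₁) := by
    rw [e2]; field_simp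
  have h5 : α * m ^ (α - 1) * (r₂ - r₁) ≤ α * r₁ ^ (α - 1) * (r₂ - r₁) := by
    have := sub_nonneg.2 h12
    gcongr
  linarith

/-- A spherical shell of thickness `m^{1-α}`, given as a level set of `|ξ|^α` at scale one, meets
a ball of radius `1/4` in measure `O(m^{1-α})`: many translates of the intersection in the radial
direction are disjoint. -/
theorem volume_shell_le {α m : ℝ} (hα : 1 ≤ α) (hm : 1 ≤ m) (ζ : Space d) (σ : ℝ) :
    volume {η : Space d | η ∈ Metric.ball (0 : Space d) (1 / 4) ∧ m ≤ ‖ζ - η‖ ∧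
      |σ - ‖ζ - η‖ ^ α| ≤ 1 / 2} ≤
      ENNReal.ofReal (m ^ (1 - α)) * volume (Metric.ball (0 : Space d) 7) := by
  set A : Set (Space d) := {η : Space d | η ∈ Metric.ball (0 : Space d) (1 / 4) ∧ m ≤ ‖ζ - η‖ ∧
      |σ - ‖ζ - η‖ ^ α| ≤ 1 / 2} with hA
  have hm0 : 0 < m := by linarith
  have hAm : MeasurableSet A := by
    have h1 : Measurable fun η : Space d => ζ - η := by fun_prop
    have h2 : Measurable fun η : Space d => ‖ζ - η‖ ^ α := (measurable_norm_rpow α).comp h1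
    have h3 : Measurable fun η : Space d => |σ - ‖ζ - η‖ ^ α| := by fun_prop
    exact Metric.isOpen_ball.measurableSet.inter ((measurableSet_le measurable_const h1.norm).inter
      (measurableSet_le h3 measurable_const))
  set δ : ℝ := m ^ (1 - α) with hδ
  have hδ0 : 0 < δ := by positivity
  have hδ1 : δ ≤ 1 := Real.rpow_le_one_of_one_le_of_nonpos hm (by linarith)
  have hδm : δ * m ^ (α - 1) = 1 := by
    rw [hδ, ← Real.rpow_add hm0]; simp
  set e : Space d := ‖ζ‖⁻¹ • ζ with he
  have hnear : ∀ η₁ ∈ A, ∀ η₂ ∈ A, ‖ζ - η₁‖ - ‖ζ - η₂‖ ≤ δ := by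
    intro η₁ h₁ η₂ h₂
    by_contra! hcon
    have h3 := mul_sub_le_rpow_sub_rpow hα hm0 h₂.2.1 (by linarith : ‖ζ - η₂‖ ≤ ‖ζ - η₁‖)
    have h4 := abs_le.1 h₁.2.2
    have h5 := abs_le.1 h₂.2.2
    have h6 : 0 < m ^ (α - 1) := by positivity
    have h7 : δ * m ^ (α - 1) < (‖ζ - η₁‖ - ‖ζ - η₂‖) * m ^ (α - 1) := by gcongr
    nlinarith
  set N : ℕ := ⌈1 / δ⌉₊ with hN
  have hN1 : 1 / δ ≤ N := Nat.le_ceil _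
  have hN2 : (N : ℝ) * δ ≤ 2 := by
    have := (Nat.ceil_lt_add_one (by positivity : 0 ≤ 1 / δ)).le
    calc (N : ℝ) * δ ≤ (1 / δ + 1) * δ := by gcongr
      _ = 1 + δ := by field_simp
      _ ≤ 2 := by linarith
  have he1 : ‖e‖ ≤ 1 := by
    rw [he, norm_smul, norm_inv, norm_norm]
    exact inv_mul_le_one
  set T : ℕ → Set (Space d) := fun k => (fun η => η + (3 * δ * k) • e) ⁻¹' A with hT
  have hvol : ∀ k, volume (T k) = volume A := fun k => measure_preimage_add_right _ _ _
  have hdis : ∀ k l : ℕ, k < l → Disjoint (T k) (T l) := by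
    intro k l hkl
    rw [Set.disjoint_left]
    intro η hk hl
    have hk' : η + (3 * δ * k) • e ∈ A := hk
    have hl' : η + (3 * δ * l) • e ∈ A := hl
    have h1 := hnear _ hk' _ hl'
    set v := ζ - (η + (3 * δ * l) • e) with hv
    have hv1 : 1 ≤ ‖v‖ := hm.trans hl'.2.1
    have hv2 : ‖ζ - v‖ < 1 / 4 := by
      rw [hv, sub_sub_cancel]
      simpa using hl'.1
    have hkl' : (k : ℝ) + 1 ≤ l := by exact_mod_cast hkl
    have hs : 3 * δ ≤ 3 * δ * l - 3 * δ * k := by nlinarith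
    have h2 := norm_add_half_le_norm_add hv1 hv2 (s := 3 * δ * l - 3 * δ * k) (by linarith)
    have h3 : v + (3 * δ * l - 3 * δ * k) • e = ζ - (η + (3 * δ * k) • e) := by
      rw [hv, sub_smul]; abel
    rw [← he, h3] at h2
    linarith
  have hpair : (Finset.range N : Set ℕ).PairwiseDisjoint T := by
    intro k _ l _ hkl
    rcases lt_or_gt_of_ne hkl with h | h
    · exact hdis k l h
    · exact (hdis l k h).symm
  have hsub : (⋃ k ∈ Finset.range N, T k) ⊆ Metric.ball (0 : Space d) 7 := by
    intro η hη
    simp only [mem_iUnion, Finset.mem_range] at hη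
    obtain ⟨k, hk, hη⟩ := hη
    have h1 : ‖η + (3 * δ * k) • e‖ < 1 / 4 := by simpa using hη.1
    have h2 : ‖(3 * δ * k) • e‖ ≤ 6 := by
      rw [norm_smul, Real.norm_eq_abs, abs_of_nonneg (by positivity)]
      have : (k : ℝ) ≤ N := by exact_mod_cast hk.le
      have : δ * k ≤ 2 := by nlinarith
      nlinarith [norm_nonneg e, mul_nonneg hδ0.le (Nat.cast_nonneg k : (0 : ℝ) ≤ k)]
    have h3 := norm_sub_le (η + (3 * δ * k) • e) ((3 * δ * k) • e)
    rw [add_sub_cancel_right] at h3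
    rw [mem_ball_zero_iff]
    linarith
  have hcount : (N : ℝ≥0∞) * volume A ≤ volume (Metric.ball (0 : Space d) 7) := by
    refine le_trans ?_ (measure_mono hsub)
    rw [measure_biUnion_finset hpair fun k _ => hAm.preimage (by fun_prop)]
    simp [hvol]
  calc volume A = ENNReal.ofReal (δ * (1 / δ)) * volume A := by
        rw [mul_one_div_cancel hδ0.ne']; simp
    _ ≤ ENNReal.ofReal (δ * N) * volume A := by gcongr
    _ = ENNReal.ofReal δ * ((N : ℝ≥0∞) * volume A) := by
        rw [ENNReal.ofReal_mul hδ0.le, ENNReal.ofReal_natCast, mul_assoc]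
    _ ≤ _ := by gcongr

end Shell

/-! ### Localization in time -/

section TimeLocalization

variable {d : ℕ} {α a b L : ℝ}

theorem evolution_modulate (α t s : ℝ) (g : Space d → ℂ) (x : Space d) :
    evolution α t (fun ξ => Complex.exp (Complex.I * ((s * ‖ξ‖ ^ α : ℝ) : ℂ)) * g ξ) x =
      evolution α (t + s) g x := by
  refine integral_congr_ae (.of_forall fun ξ => ?_)
  simp only
  rw [← mul_assoc, ← Complex.exp_add]
  congr 2
  push_cast
  ring

theorem measurable_time_phase (α : ℝ) : Measurable fun p : ℝ × Space d =>
    Complex.exp (Complex.I * ((p.1 * ‖p.2‖ ^ α : ℝ) : ℂ)) := by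
  have : Measurable fun p : ℝ × Space d => ‖p.2‖ ^ α :=
    (measurable_norm_rpow α).comp measurable_snd
  fun_prop

theorem Band.modulate {g : Space d → ℂ} (hg : Band a b g) (α s : ℝ) :
    Band a b (fun ξ => Complex.exp (Complex.I * ((s * ‖ξ‖ ^ α : ℝ) : ℂ)) * g ξ) :=
  hg.mul_unimodular ((measurable_time_phase α).comp (measurable_const (a := s) |>.prodMk
    measurable_id)) fun _ => norm_phase _

/-- For `α ≥ 1` a maximal bound at frequencies `≈ m` on the short time interval `[0, δ]`,
`δ ≥ m^{1-α}`, propagates to unit time: by local smoothing the pieces of `f` which are in the unit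
ball at different times are almost orthogonal. -/
theorem exists_maxBound_of_short_times (d : ℕ) {α κ : ℝ} (hα : 1 ≤ α) (hκ0 : 0 ≤ κ) :
    ∃ C : ℝ≥0∞, C ≠ ∞ ∧ ∀ (m b L δ : ℝ) (μ : Measure (Space d)) (K : ℝ≥0∞),
      SFinite μ → 1 ≤ m → m ^ (1 - α) ≤ δ → δ ≤ 1 → SlowSymbol d α m b L → δ * L ≤ κ →
      MaxBound α (Icc 0 δ) (μ.restrict (Metric.ball 0 1)) (m - 1 / 4) (b + 1 / 4) K →
      MaxBound α (Ioc 0 1) (μ.restrict (Metric.ball 0 1)) m b (C * K) := by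
  set V := volume (Metric.ball (0 : Space d) (1 / 4)) with hV
  have hV0 : V ≠ 0 := (Metric.measure_ball_pos _ _ (by norm_num)).ne'
  have hVt : V ≠ ∞ := measure_ball_lt_top.ne
  set W := volume (Metric.ball (0 : Space d) 7) with hW
  have hWt : W ≠ ∞ := measure_ball_lt_top.ne
  have hπ : 0 < 2 * Real.pi := by positivity
  set Q := (V / 2) ^ 2 * ENNReal.ofReal ((2 * Real.pi)⁻¹) with hQ
  have hQ0 : Q ≠ 0 := mul_ne_zero (pow_ne_zero _ (ENNReal.div_ne_zero.2 ⟨hV0, by norm_num⟩))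
    (by simpa using Real.pi_pos)
  have hV2 : (V / 2) ^ 2 ≠ ∞ := ENNReal.pow_ne_top (ENNReal.div_ne_top hVt (by norm_num))
  have hQt : Q ≠ ∞ := ENNReal.mul_ne_top hV2 ENNReal.ofReal_ne_top
  set E := ENNReal.ofReal (Real.exp κ) ^ 2 * (4 * W) * V with hE
  have hEt : E ≠ ∞ := ENNReal.mul_ne_top (ENNReal.mul_ne_top (ENNReal.pow_ne_top
    ENNReal.ofReal_ne_top) (ENNReal.mul_ne_top (by norm_num) hWt)) hVt
  refine ⟨Q⁻¹ * E, ENNReal.mul_ne_top (ENNReal.inv_ne_top.2 hQ0) hEt, ?_⟩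
  intro m b L δ μ K hμ hm hmδ hδ1 hS hκ hK g hg
  set μ' := μ.restrict (Metric.ball 0 1) with hμ'
  have hm0 : 0 < m := by linarith
  have hδ0 : 0 < δ := lt_of_lt_of_le (by positivity) hmδ
  set ω := ENNReal.ofReal (m ^ (1 - α)) with hω
  have hω0 : ω ≠ 0 := by
    have : 0 < m ^ (1 - α) := by positivity
    simpa [hω] using this
  have hωt : ω ≠ ∞ := ENNReal.ofReal_ne_top
  set J : Set ℝ := Icc (-(2 * Real.pi)⁻¹) ((2 * Real.pi)⁻¹) with hJ
  set gs : ℝ → Space d → ℂ := fun τ ξ =>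
    Complex.exp (Complex.I * ((-(2 * Real.pi * τ) * ‖ξ‖ ^ α : ℝ) : ℂ)) * g ξ with hgs
  have hgsB : ∀ τ, Band m b (gs τ) := fun τ => hg.modulate α _
  have hgsm : Measurable fun p : ℝ × Space d => gs p.1 p.2 := by
    have h1 : Measurable fun p : ℝ × Space d => g p.2 := hg.measurable.comp measurable_snd
    have h2 := (measurable_time_phase (d := d) α).comp
      (by fun_prop : Measurable fun p : ℝ × Space d => (-(2 * Real.pi * p.1), p.2))
    exact h2.mul h1
  have hev : ∀ u τ x, evolution α u (gs τ) x = evolution α (u - 2 * Real.pi * τ) g x := by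
    intro u τ x
    rw [sub_eq_add_neg]
    exact evolution_modulate α u _ g x
  have main := lintegral_maxEnergy_le (volume.restrict J) (q := fun _ _ => 1) (g := gs)
    (g₀ := g) (S := Icc 0 δ) (κ := κ) (c := V / 2) (K := K) (D := ω * (4 * W))
    (μ := fun _ => μ') hS hg.measurable hgsB hgsm measurable_const (by simp) hκ0 ?_
    ?_ (fun _ => hK) ?_
  · set M : Space d → ℝ → ℝ≥0∞ := fun x τ =>
      (⨆ u ∈ Icc 0 δ, ‖evolution α u (gs τ) x‖ₑ) ^ 2 with hM
    have hMm : Measurable fun p : Space d × ℝ => M p.1 p.2 := by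
      refine Measurable.pow_const (LowerSemicontinuous.measurable ?_) 2
      refine lowerSemicontinuous_biSup fun u _ => Continuous.lowerSemicontinuous ?_
      simp only [hev]
      exact ((continuous_evolution hg.integrable α).comp (by fun_prop :
        Continuous fun p : Space d × ℝ => (u - 2 * Real.pi * p.2, p.1))).enorm
    have hpt : ∀ x, ENNReal.ofReal (δ / (2 * Real.pi)) *
        (⨆ t ∈ Ioc (0 : ℝ) 1, ‖evolution α t g x‖ₑ) ^ 2 ≤ ∫⁻ τ in J, M x τ := by
      intro x
      have hsq : (⨆ t ∈ Ioc (0 : ℝ) 1, ‖evolution α t g x‖ₑ) ^ 2 =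
          ⨆ t ∈ Ioc (0 : ℝ) 1, ‖evolution α t g x‖ₑ ^ 2 := by
        simp only [ENNReal.iSup_pow_of_ne_zero two_ne_zero]
      rw [hsq, ENNReal.mul_iSup]
      refine iSup_le fun t => ?_
      rw [ENNReal.mul_iSup]
      refine iSup_le fun ht => ?_
      set T : Set ℝ := Icc (-t / (2 * Real.pi)) ((δ - t) / (2 * Real.pi)) with hT
      have hTJ : T ⊆ J := by
        refine Icc_subset_Icc ?_ ?_
        · rw [le_div_iff₀ hπ, neg_mul, inv_mul_cancel₀ hπ.ne']
          linarith [ht.2]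
        · rw [div_le_iff₀ hπ, inv_mul_cancel₀ hπ.ne']
          linarith [ht.1]
      have hTM : ∀ τ ∈ T, ‖evolution α t g x‖ₑ ^ 2 ≤ M x τ := by
        intro τ hτ
        have h1 := (div_le_iff₀ hπ).1 hτ.1
        have h2 := (le_div_iff₀ hπ).1 hτ.2
        refine pow_le_pow_left₀ (by positivity) ?_ 2
        have h3 : t + 2 * Real.pi * τ ∈ Icc 0 δ := ⟨by linarith, by linarith⟩
        have h4 := le_biSup (fun u => ‖evolution α u (gs τ) x‖ₑ) h3
        simp only [hev, add_sub_cancel_right] at h4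
        simpa only [hev] using h4
      calc ENNReal.ofReal (δ / (2 * Real.pi)) * ‖evolution α t g x‖ₑ ^ 2
          = ∫⁻ _ in T, ‖evolution α t g x‖ₑ ^ 2 := by
            rw [setLIntegral_const, hT, Real.volume_Icc, mul_comm]
            congr 2
            ring
        _ ≤ ∫⁻ τ in T, M x τ := setLIntegral_mono' measurableSet_Icc hTM
        _ ≤ ∫⁻ τ in J, M x τ := lintegral_mono_set hTJ
    have hfub : ENNReal.ofReal (δ / (2 * Real.pi)) * maxEnergy α (Ioc 0 1) μ' g ≤
        ∫⁻ τ in J, maxEnergy α (Icc 0 δ) μ' (gs τ) := by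
      unfold maxEnergy
      rw [← lintegral_const_mul' _ _ ENNReal.ofReal_ne_top]
      refine (lintegral_mono hpt).trans_eq ?_
      exact lintegral_lintegral_swap hMm.aemeasurable
    rw [lintegral_const_mul' _ _ hV2] at main
    have hfin : ω * (Q * maxEnergy α (Ioc 0 1) μ' g) ≤ ω * (E * K * energy g) := by
      calc ω * (Q * maxEnergy α (Ioc 0 1) μ' g)
          ≤ (V / 2) ^ 2 * (ENNReal.ofReal (δ / (2 * Real.pi)) *
              maxEnergy α (Ioc 0 1) μ' g) := by
            have : ω * ENNReal.ofReal ((2 * Real.pi)⁻¹) ≤ ENNReal.ofReal (δ / (2 * Real.pi)) := by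
              rw [hω, ← ENNReal.ofReal_mul (by positivity), div_eq_mul_inv]
              exact ENNReal.ofReal_le_ofReal (by gcongr)
            calc _ = (V / 2) ^ 2 * ((ω * ENNReal.ofReal ((2 * Real.pi)⁻¹)) *
                  maxEnergy α (Ioc 0 1) μ' g) := by rw [hQ]; ring
              _ ≤ _ := by gcongr
        _ ≤ _ := by gcongr
        _ ≤ _ := main
        _ = _ := by rw [hE]; ring
    have hfin' := (ENNReal.mul_le_mul_iff_right hω0 hωt).1 hfin
    calc maxEnergy α (Ioc 0 1) μ' g = Q⁻¹ * (Q * maxEnergy α (Ioc 0 1) μ' g) := by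
          rw [← mul_assoc, ENNReal.inv_mul_cancel hQ0 hQt, one_mul]
      _ ≤ Q⁻¹ * (E * K * energy g) := by gcongr
      _ = _ := by ring
  · intro t ht
    rw [abs_of_nonneg ht.1]
    refine le_trans ?_ hκ
    have := hS.1
    gcongr
    exact ht.2
  · intro τ
    filter_upwards [ae_restrict_mem Metric.isOpen_ball.measurableSet] with x hx
    have h := half_volume_le_enorm_integral x (by simpa using (mem_ball_zero_iff.1 hx).le)
    simpa only [mul_one] using h
  · intro n ζ
    set h : Space d → ℂ := fun η =>
      g (ζ - η) * (((‖ζ - η‖ ^ α - ‖ζ‖ ^ α) / L : ℝ) : ℂ) ^ n with hh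
    have hhm : Measurable h := by
      have := measurable_taylor_integrand (measurable_const (a := (1 : ℂ))) hg.measurable α L n
      have h2 := this.comp (measurable_const (a := ζ) |>.prodMk measurable_id)
      simpa only [Function.comp_def, one_mul, id] using h2
    have hhle : ∀ η ∈ Metric.ball (0 : Space d) (1 / 4), ‖h η‖ₑ ^ 2 ≤ ‖g (ζ - η)‖ₑ ^ 2 := by
      intro η hη
      have := norm_taylor_integrand_le hS hg (q := fun _ => 1) (by simp) n ζ η (by simpa using hη)
      simp only [one_mul] at this
      exact pow_le_pow_left₀ (by positivity) (enorm_le_iff_norm_le.2 this) 2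
    have hle : ∫⁻ η in Metric.ball (0 : Space d) (1 / 4), ‖h η‖ₑ ^ 2 ≤
        ∫⁻ η in Metric.ball (0 : Space d) (1 / 4), ‖g (ζ - η)‖ₑ ^ 2 :=
      setLIntegral_mono' Metric.isOpen_ball.measurableSet hhle
    have hfin : ∫⁻ η in Metric.ball (0 : Space d) (1 / 4), ‖h η‖ₑ ^ 2 < ∞ := by
      refine (hle.trans (setLIntegral_le_lintegral _ _)).trans_lt ?_
      rw [lintegral_sub_left_eq_self (fun ξ => ‖g ξ‖ₑ ^ 2) ζ]
      exact hg.energy_lt_top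
    have hball : IsFiniteMeasure (volume.restrict (Metric.ball (0 : Space d) (1 / 4))) :=
      ⟨by simpa using measure_ball_lt_top⟩
    have hpm : Measurable fun η : Space d => ‖ζ - η‖ ^ α :=
      (measurable_norm_rpow α).comp (by fun_prop : Measurable fun η : Space d => ζ - η)
    have key := lintegral_oscillatory_sq_le (volume.restrict (Metric.ball (0 : Space d) (1 / 4)))
      hpm hhm hfin (m := ω * W) (ENNReal.mul_ne_top hωt hWt) (by
        intro σ
        rw [Measure.restrict_apply' Metric.isOpen_ball.measurableSet]
        refine (measure_mono ?_).trans (volume_shell_le hα hm ζ σ)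
        rintro η ⟨⟨h0, h1⟩, h2⟩
        exact ⟨h2, (hg.supp _ (left_ne_zero_of_mul h0)).1, h1⟩)
    calc ∫⁻ τ in J, ‖taylorCoeff α L (fun _ => 1) (gs τ) n ζ‖ₑ ^ 2
        = ∫⁻ τ in J, ‖∫ η in Metric.ball (0 : Space d) (1 / 4),
            Complex.exp (Complex.I * ((-(2 * Real.pi * τ * ‖ζ - η‖ ^ α) : ℝ) : ℂ)) * h η‖ₑ ^ 2 := by
          refine lintegral_congr fun τ => ?_
          congr 2
          refine integral_congr_ae (.of_forall fun η => ?_)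
          simp only [hgs, hh, one_mul, neg_mul, mul_assoc]
      _ ≤ 4 * (ω * W) * ∫⁻ η in Metric.ball (0 : Space d) (1 / 4), ‖h η‖ₑ ^ 2 := key
      _ ≤ 4 * (ω * W) * ∫⁻ η in Metric.ball (0 : Space d) (1 / 4), ‖g (ζ - η)‖ₑ ^ 2 := by gcongr
      _ = _ := by ring

end TimeLocalization

/-! ### Symmetries and comparison of symbols -/

section Measures

variable {d : ℕ} {γ : ℝ} {μ : Measure (Space d)} {C : ℝ≥0}

theorem ballBound_dimConst (h : IsDimensional γ μ) : BallBound γ μ (dimConst γ μ) := by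
  intro x r hr
  set w := ENNReal.ofReal (r ^ γ) with hw
  have hw0 : w ≠ 0 := by
    have : 0 < r ^ γ := Real.rpow_pos_of_pos hr γ
    simpa [hw] using this
  rw [← ENNReal.div_le_iff hw0 ENNReal.ofReal_ne_top]
  refine le_of_forall_gt fun y hy => ?_
  induction y with
  | top =>
    obtain ⟨C, hC⟩ := h
    exact ((ENNReal.div_le_iff hw0 ENNReal.ofReal_ne_top).2 (hC x r hr)).trans_lt
      ENNReal.coe_lt_top
  | coe y =>
    obtain ⟨C, hC, hCy⟩ := exists_lt_of_csInf_lt h (ENNReal.coe_lt_coe.1 hy)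
    exact ((ENNReal.div_le_iff hw0 ENNReal.ofReal_ne_top).2 (hC x r hr)).trans_lt
      (ENNReal.coe_lt_coe.2 hCy)

theorem dimConst_le (h : BallBound γ μ C) : dimConst γ μ ≤ C :=
  csInf_le (OrderBot.bddBelow _) h

theorem BallBound.sFinite (h : BallBound γ μ C) : SFinite μ := by
  have : IsLocallyFiniteMeasure μ := ⟨fun x => ⟨Metric.ball x 1, Metric.ball_mem_nhds x one_pos,
    (h x 1 one_pos).trans_lt (ENNReal.mul_lt_top ENNReal.coe_lt_top ENNReal.ofReal_lt_top)⟩⟩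
  infer_instance

theorem BallBound.map_sub (h : BallBound γ μ C) (v : Space d) :
    BallBound γ (μ.map fun x => x - v) C := by
  intro x r hr
  rw [Measure.map_apply (by fun_prop) Metric.isOpen_ball.measurableSet]
  have : (fun x => x - v) ⁻¹' Metric.ball x r = Metric.ball (x + v) r := by
    ext y
    simp [dist_eq_norm, sub_sub, add_comm]
  rw [this]
  exact h _ r hr

theorem BallBound.map_smul (h : BallBound γ μ C) {ρ : ℝ} (hρ : 0 < ρ) :
    BallBound γ (μ.map fun x => ρ⁻¹ • x) (C * (ρ ^ γ).toNNReal) := by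
  intro x r hr
  rw [Measure.map_apply (by fun_prop) Metric.isOpen_ball.measurableSet]
  have : (fun x => ρ⁻¹ • x) ⁻¹' Metric.ball x r = Metric.ball (ρ • x) (ρ * r) := by
    ext y
    have e : ρ⁻¹ • y - x = ρ⁻¹ • (y - ρ • x) := by rw [smul_sub, inv_smul_smul₀ hρ.ne']
    simp only [mem_preimage, Metric.mem_ball, dist_eq_norm, e, norm_smul, norm_inv,
      Real.norm_eq_abs, abs_of_pos hρ]
    rw [inv_mul_lt_iff₀ hρ]
  rw [this]
  refine (h _ _ (by positivity)).trans_eq ?_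
  rw [Real.mul_rpow hρ.le hr.le, ENNReal.ofReal_mul (by positivity), ENNReal.coe_mul, mul_assoc]
  rfl

end Measures

section Symmetries

variable {d : ℕ} {α a b : ℝ} {g : Space d → ℂ} {S S' : Set ℝ} {μ : Measure (Space d)} {K : ℝ≥0∞}

theorem evolution_translate (α t : ℝ) (g : Space d → ℂ) (v x : Space d) :
    evolution α t (fun ξ => Complex.exp (Complex.I * ((inner ℝ v ξ : ℝ) : ℂ)) * g ξ) x =
      evolution α t g (x + v) := by
  refine integral_congr_ae (.of_forall fun ξ => ?_)
  simp only [inner_add_left]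
  rw [← mul_assoc, ← Complex.exp_add]
  congr 2
  push_cast
  ring

theorem MaxBound.translate_space (v : Space d)
    (h : MaxBound α S ((μ.map fun x => x - v).restrict (Metric.ball 0 1)) a b K) :
    MaxBound α S (μ.restrict (Metric.ball v 1)) a b K := by
  intro g hg
  have hm : ∀ ξ : Space d, ‖Complex.exp (Complex.I * ((inner ℝ v ξ : ℝ) : ℂ))‖ = 1 :=
    fun ξ => norm_phase _
  have hg' : Band a b (fun ξ => Complex.exp (Complex.I * ((inner ℝ v ξ : ℝ) : ℂ)) * g ξ) :=
    hg.mul_unimodular (by fun_prop) hm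
  have h1 := h _ hg'
  rw [energy_mul_unimodular hm] at h1
  refine le_trans (le_of_eq ?_) h1
  have hmeas := (measurable_maximal hg'.integrable α S).pow_const 2
  unfold maxEnergy
  rw [Measure.restrict_map (by fun_prop) Metric.isOpen_ball.measurableSet,
    lintegral_map hmeas (by fun_prop)]
  simp only [evolution_translate, sub_add_cancel]
  congr 2
  ext y
  simp [dist_eq_norm]

theorem MaxBound.translate_time (t₀ : ℝ) (hS : ∀ t ∈ S, t - t₀ ∈ S') (h : MaxBound α S' μ a b K) :
    MaxBound α S μ a b K := by
  intro g hg
  have h1 := h _ (hg.modulate α t₀)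
  rw [energy_mul_unimodular fun _ => norm_phase _] at h1
  refine le_trans (lintegral_mono fun x => ?_) h1
  refine pow_le_pow_left₀ (by positivity) (iSup₂_le fun t ht => ?_) 2
  have := le_biSup (fun t => ‖evolution α t (fun ξ =>
    Complex.exp (Complex.I * ((t₀ * ‖ξ‖ ^ α : ℝ) : ℂ)) * g ξ) x‖ₑ) (hS t ht)
  simp only [evolution_modulate, sub_add_cancel] at this
  simpa only [evolution_modulate] using this

theorem lintegral_comp_inv_smul {ρ : ℝ} (hρ : 0 < ρ) {u : Space d → ℝ≥0∞} (hu : Measurable u) :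
    ∫⁻ ξ, u (ρ⁻¹ • ξ) = ENNReal.ofReal (ρ ^ d) * ∫⁻ ξ, u ξ := by
  have h := Measure.map_addHaar_smul (volume : Measure (Space d)) (inv_ne_zero hρ.ne')
  have h2 := lintegral_map (μ := volume) hu (by fun_prop : Measurable fun ξ : Space d => ρ⁻¹ • ξ)
  rw [← h2, h, lintegral_smul_measure]
  simp [abs_of_pos hρ]

theorem energy_comp_inv_smul {ρ : ℝ} (hρ : 0 < ρ) (hg : Measurable g) :
    energy (fun ξ => g (ρ⁻¹ • ξ)) = ENNReal.ofReal (ρ ^ d) * energy g :=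
  lintegral_comp_inv_smul hρ (u := fun ξ => ‖g ξ‖ₑ ^ 2) (hg.enorm.pow_const 2)

theorem Band.comp_inv_smul (hg : Band a b g) {ρ : ℝ} (hρ : 0 < ρ) :
    Band (ρ * a) (ρ * b) (fun ξ => g (ρ⁻¹ • ξ)) := by
  refine ⟨hg.measurable.comp (by fun_prop), fun ξ hξ => ?_, ?_⟩
  · have h := hg.supp _ hξ
    rw [norm_smul, norm_inv, Real.norm_eq_abs, abs_of_pos hρ, ← div_eq_inv_mul,
      le_div_iff₀' hρ, div_le_iff₀' hρ] at h
    exact h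
  · rw [energy_comp_inv_smul hρ hg.measurable]
    exact ENNReal.mul_lt_top ENNReal.ofReal_lt_top hg.energy_lt_top

theorem evolution_rescale {ρ : ℝ} (hρ : 0 < ρ) (α t : ℝ) (g : Space d → ℂ) (x : Space d) :
    evolution α (t * ρ ^ (-α)) (fun ξ => g (ρ⁻¹ • ξ)) x =
      ((ρ ^ d : ℝ) : ℂ) * evolution α t g (ρ • x) := by
  have h := Measure.integral_comp_smul (volume : Measure (Space d))
    (fun ξ => Complex.exp (Complex.I * ((inner ℝ (ρ • x) ξ + t * ‖ξ‖ ^ α : ℝ) : ℂ)) * g ξ) ρ⁻¹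
  have hc : |((ρ⁻¹) ^ Module.finrank ℝ (Space d))⁻¹| = ρ ^ d := by
    simp [abs_of_pos hρ]
  rw [hc] at h
  unfold evolution
  rw [← Complex.real_smul, ← h]
  refine integral_congr_ae (.of_forall fun ξ => ?_)
  simp only
  congr 4
  rw [real_inner_smul_left, real_inner_smul_right, norm_smul, norm_inv, Real.norm_eq_abs,
    abs_of_pos hρ, Real.mul_rpow (by positivity) (norm_nonneg _), Real.inv_rpow hρ.le,
    Real.rpow_neg hρ.le, mul_inv_cancel_left₀ hρ.ne', mul_assoc]

theorem MaxBound.rescale {ρ : ℝ} (hρ : 0 < ρ) (hS : ∀ t ∈ S, t * ρ ^ (-α) ∈ S')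
    (h : MaxBound α S' (μ.map fun x => ρ⁻¹ • x) (ρ * a) (ρ * b) K) :
    MaxBound α S μ a b ((ENNReal.ofReal (ρ ^ d))⁻¹ * K) := by
  intro g hg
  set c := ENNReal.ofReal (ρ ^ d) with hc
  have hc0 : c ≠ 0 := by
    have : 0 < ρ ^ d := by positivity
    simpa [hc] using this
  have hct : c ≠ ∞ := ENNReal.ofReal_ne_top
  have hg' := hg.comp_inv_smul hρ
  have h1 := h _ hg'
  rw [energy_comp_inv_smul hρ hg.measurable] at h1
  have hmeas := (measurable_maximal hg'.integrable α S').pow_const 2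
  have hmeas2 := (measurable_maximal hg.integrable α S).pow_const 2
  have h2 : c ^ 2 * maxEnergy α S μ g ≤
      maxEnergy α S' (μ.map fun x => ρ⁻¹ • x) (fun ξ => g (ρ⁻¹ • ξ)) := by
    unfold maxEnergy
    rw [lintegral_map hmeas (by fun_prop), ← lintegral_const_mul' _ _ (ENNReal.pow_ne_top hct)]
    refine lintegral_mono fun x => ?_
    rw [← mul_pow]
    refine pow_le_pow_left₀ (by positivity) ?_ 2
    rw [ENNReal.mul_iSup]
    refine iSup_le fun t => ?_
    rw [ENNReal.mul_iSup]
    refine iSup_le fun ht => ?_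
    refine le_trans (le_of_eq ?_) (le_biSup (fun t => ‖evolution α t (fun ξ => g (ρ⁻¹ • ξ))
      (ρ⁻¹ • x)‖ₑ) (hS t ht))
    simp only
    rw [evolution_rescale hρ, smul_inv_smul₀ hρ.ne', enorm_mul]
    congr 1
    rw [← ofReal_norm, Complex.norm_real, Real.norm_eq_abs, abs_of_pos (by positivity)]
  calc maxEnergy α S μ g = (c⁻¹ * c) * (c⁻¹ * c) * maxEnergy α S μ g := by
        rw [ENNReal.inv_mul_cancel hc0 hct, one_mul, one_mul]
    _ = c⁻¹ * c⁻¹ * (c ^ 2 * maxEnergy α S μ g) := by ring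
    _ ≤ c⁻¹ * c⁻¹ * (K * (c * energy g)) := mul_le_mul' le_rfl (h2.trans h1)
    _ = (c⁻¹ * c) * (c⁻¹ * K * energy g) := by ring
    _ = c⁻¹ * K * energy g := by rw [ENNReal.inv_mul_cancel hc0 hct, one_mul]

end Symmetries

section Symbol

theorem rpow_le_mul_rpow {c m r : ℝ} (hc : 1 ≤ c) (hm : 0 < m) (h1 : m / c ≤ r) (h2 : r ≤ c * m)
    (p : ℝ) : r ^ p ≤ c ^ |p| * m ^ p := by
  have hc0 : 0 < c := by linarith
  have hr : 0 < r := lt_of_lt_of_le (by positivity) h1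
  rcases le_total 0 p with hp | hp
  · rw [abs_of_nonneg hp, ← Real.mul_rpow hc0.le hm.le]
    exact Real.rpow_le_rpow hr.le h2 hp
  · rw [abs_of_nonpos hp, Real.rpow_neg hc0.le, ← Real.inv_rpow hc0.le,
      ← Real.mul_rpow (by positivity) hm.le, ← div_eq_inv_mul]
    exact Real.rpow_le_rpow_of_nonpos (by positivity) h1 hp

theorem slowSymbol (d : ℕ) {α m : ℝ} (hα : 0 < α) (hm : 1 ≤ m) :
    SlowSymbol d α m (3 / 2 * m) (α * (2 ^ |α - 1| * m ^ (α - 1))) := by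
  have hm0 : 0 < m := by linarith
  have hL : 0 < α * (2 ^ |α - 1| * m ^ (α - 1)) := by positivity
  refine ⟨hL, fun ξ η h1 h2 hη => ?_⟩
  have h3 : |‖ξ‖ - ‖ξ + η‖| ≤ 1 / 4 := by
    refine (abs_norm_sub_norm_le ξ (ξ + η)).trans ?_
    rw [sub_add_cancel_left, norm_neg]
    exact hη.le
  have h4 := abs_le.1 h3
  have hd : ∀ r ∈ Icc (m / 2) (2 * m),
      HasDerivWithinAt (fun r : ℝ => r ^ α) (α * r ^ (α - 1)) (Icc (m / 2) (2 * m)) r := by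
    intro r hr
    have : r ≠ 0 := (lt_of_lt_of_le (by positivity) hr.1).ne'
    exact (Real.hasDerivAt_rpow_const (Or.inl this)).hasDerivWithinAt
  have hb : ∀ r ∈ Icc (m / 2) (2 * m), ‖α * r ^ (α - 1)‖ ≤ α * (2 ^ |α - 1| * m ^ (α - 1)) := by
    intro r hr
    have hr0 : 0 < r := lt_of_lt_of_le (by positivity) hr.1
    rw [Real.norm_eq_abs, abs_of_pos (by positivity)]
    gcongr
    exact rpow_le_mul_rpow (by norm_num) hm0 hr.1 hr.2 _
  have h := (convex_Icc (m / 2) (2 * m)).norm_image_sub_le_of_norm_hasDerivWithin_le hd hb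
    (x := ‖ξ + η‖) (y := ‖ξ‖) ⟨by linarith, by linarith⟩ ⟨by linarith, by linarith⟩
  rw [Real.norm_eq_abs, Real.norm_eq_abs] at h
  nlinarith

end Symbol

/-! ### The maximal inequality on the Fourier side -/

section Bridge

variable {d : ℕ} {α R : ℝ} {S : Set ℝ} {μ : Measure (Space d)} {f : LTwo d} {g : Space d → ℂ}

theorem measurable_fhat (f : LTwo d) : Measurable (fhat f) :=
  (Lp.stronglyMeasurable (𝓕 f : LTwo d)).measurable.comp (by fun_prop)

theorem energy_fhat (f : LTwo d) :
    energy (fhat f) = ENNReal.ofReal ((2 * Real.pi) ^ d) * ‖f‖ₑ ^ 2 := by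
  have h := energy_comp_inv_smul (d := d) (ρ := 2 * Real.pi) (by positivity)
    (Lp.stronglyMeasurable (𝓕 f : LTwo d)).measurable
  refine h.trans ?_
  rw [energy, lintegral_enorm_sq_eq_eLpNorm_sq, ← Lp.enorm_def, ← ofReal_norm, Lp.norm_fourier_eq,
    ofReal_norm]

/-- Every square integrable function on frequency space is a Fourier transform. -/
theorem exists_fhat_ae_eq (hg : Measurable g) (hg2 : energy g < ∞) :
    ∃ f : LTwo d, fhat f =ᵐ[volume] g := by
  have hπ : 0 < 2 * Real.pi := by positivity
  set h : Space d → ℂ := fun η => g ((2 * Real.pi) • η) with hh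
  have hm : Measurable h := hg.comp (by fun_prop)
  have hL2 : MemLp h 2 := by
    refine ⟨hm.aestronglyMeasurable, ?_⟩
    have h1 : energy h < ∞ := by
      have := energy_comp_inv_smul (inv_pos.2 hπ) hg
      simp only [inv_inv] at this
      rw [hh, this]
      exact ENNReal.mul_lt_top ENNReal.ofReal_lt_top hg2
    rw [energy, lintegral_enorm_sq_eq_eLpNorm_sq] at h1
    exact (ENNReal.pow_lt_top_iff.1 h1).resolve_right (by norm_num)
  refine ⟨𝓕⁻ (hL2.toLp h), ?_⟩
  have hq : Measure.QuasiMeasurePreserving (fun ξ : Space d => (2 * Real.pi)⁻¹ • ξ) := by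
    refine ⟨by fun_prop, ?_⟩
    rw [Measure.map_addHaar_smul (volume : Measure (Space d)) (inv_ne_zero hπ.ne')]
    exact Measure.smul_absolutelyContinuous
  filter_upwards [hq.ae_eq_comp hL2.coeFn_toLp] with ξ hξ
  simp only [Function.comp_apply] at hξ
  rw [fhat, FourierTransform.fourier_fourierInv_eq, hξ, hh]
  simp only
  rw [smul_inv_smul₀ hπ.ne']

theorem maximalNorm_sq (hfg : fhat f =ᵐ[volume] g) :
    ENNReal.ofReal ((2 * Real.pi) ^ d) ^ 2 * maximalNorm α S μ f ^ 2 =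
      maxEnergy α S (μ.restrict (Metric.ball 0 1)) g := by
  set P := ENNReal.ofReal ((2 * Real.pi) ^ d) with hP
  have hPt : P ≠ ∞ := ENNReal.ofReal_ne_top
  have hprop : ∀ t x, P * ‖propagator α t f x‖ₑ = ‖evolution α t g x‖ₑ := by
    intro t x
    have h1 : evolution α t g x = (((2 * Real.pi) ^ d : ℝ) : ℂ) * propagator α t f x := by
      rw [propagator, ← mul_assoc, ← Complex.ofReal_mul, mul_inv_cancel₀ (by positivity),
        Complex.ofReal_one, one_mul]
      refine integral_congr_ae ?_
      filter_upwards [hfg] with ξ hξ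
      rw [hξ]
    rw [h1, enorm_mul, hP]
    congr 1
    rw [← ofReal_norm (((2 * Real.pi) ^ d : ℝ) : ℂ), Complex.norm_real, Real.norm_eq_abs,
      abs_of_pos (by positivity)]
  have hsq : maximalNorm α S μ f ^ 2 = ∫⁻ x, (⨆ t ∈ S, ‖propagator α t f x‖ₑ) ^ 2
      ∂(μ.restrict (Metric.ball 0 1)) := by
    rw [maximalNorm, eLpNorm_eq_lintegral_rpow_enorm_toReal (by norm_num) (by norm_num)]
    simp only [ENNReal.toReal_ofNat, ENNReal.rpow_ofNat, one_div, enorm_eq_self]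
    rw [← ENNReal.rpow_natCast, ← ENNReal.rpow_mul]
    norm_num
  rw [hsq, ← lintegral_const_mul' _ _ (ENNReal.pow_ne_top hPt), maxEnergy]
  refine lintegral_congr fun x => ?_
  rw [← mul_pow, ENNReal.mul_iSup]
  congr 2
  funext t
  rw [ENNReal.mul_iSup]
  congr 1
  funext ht
  exact hprop t x

theorem maximalNorm_le_iff (hfg : fhat f =ᵐ[volume] g) {κ : ℝ} (hκ : 0 ≤ κ) :
    maximalNorm α S μ f ≤ ENNReal.ofReal (κ * ‖f‖) ↔
      maxEnergy α S (μ.restrict (Metric.ball 0 1)) g ≤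
        ENNReal.ofReal ((2 * Real.pi) ^ d * κ ^ 2) * energy g := by
  set P := ENNReal.ofReal ((2 * Real.pi) ^ d) with hP
  have hPt : P ≠ ∞ := ENNReal.ofReal_ne_top
  have hP0 : P ≠ 0 := by
    have : 0 < (2 * Real.pi) ^ d := by positivity
    simpa [hP] using this
  have he : energy g = P * ‖f‖ₑ ^ 2 := by
    rw [← energy_fhat]
    refine lintegral_congr_ae ?_
    filter_upwards [hfg] with ξ hξ
    rw [hξ]
  rw [← maximalNorm_sq hfg, he, ENNReal.ofReal_mul hκ, ofReal_norm,
    ENNReal.ofReal_mul (by positivity), ENNReal.ofReal_pow hκ, ← hP]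
  rw [show P * ENNReal.ofReal κ ^ 2 * (P * ‖f‖ₑ ^ 2) =
    P ^ 2 * (ENNReal.ofReal κ * ‖f‖ₑ) ^ 2 by ring]
  rw [ENNReal.mul_le_mul_iff_right (pow_ne_zero 2 hP0) (ENNReal.pow_ne_top hPt)]
  exact (ENNReal.pow_le_pow_left_iff two_ne_zero).symm

/-- The maximal inequality for functions with Fourier support in the annulus `R ≤ |ξ| ≤ 2R` is
a statement on band limited functions on frequency space. -/
theorem maximalNorm_le_iff_maxBound {κ : ℝ} (hκ : 0 ≤ κ) :
    (∀ f : LTwo d, FourierSupportedInAnnulus R f →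
        maximalNorm α S μ f ≤ ENNReal.ofReal (κ * ‖f‖)) ↔
      MaxBound α S (μ.restrict (Metric.ball 0 1)) R (2 * R)
        (ENNReal.ofReal ((2 * Real.pi) ^ d * κ ^ 2)) := by
  constructor
  · intro h g hg
    obtain ⟨f, hf⟩ := exists_fhat_ae_eq hg.measurable hg.energy_lt_top
    refine (maximalNorm_le_iff hf hκ).1 (h f ?_)
    filter_upwards [hf] with ξ hξ
    rw [hξ]
    exact hg.supp ξ
  · intro h f hf
    set A : Set (Space d) := {ξ | R ≤ ‖ξ‖ ∧ ‖ξ‖ ≤ 2 * R} with hA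
    have hAm : MeasurableSet A :=
      (measurableSet_le measurable_const measurable_norm).inter
        (measurableSet_le measurable_norm measurable_const)
    have hfg : fhat f =ᵐ[volume] A.indicator (fhat f) := by
      filter_upwards [hf] with ξ hξ
      by_cases h0 : fhat f ξ = 0
      · rw [h0]
        by_cases h1 : ξ ∈ A
        · rw [indicator_of_mem h1, h0]
        · rw [indicator_of_notMem h1]
      · rw [indicator_of_mem (show ξ ∈ A from hξ h0)]
    refine (maximalNorm_le_iff hfg hκ).2 (h _ ⟨(measurable_fhat f).indicator hAm, ?_, ?_⟩)
    · intro ξ hξ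
      exact (Set.indicator_apply_ne_zero.1 hξ).1
    · refine lt_of_le_of_lt (lintegral_mono fun ξ => ?_)
        ((energy_fhat f).trans_lt (ENNReal.mul_lt_top ENNReal.ofReal_lt_top
          (ENNReal.pow_lt_top enorm_lt_top)))
      gcongr
      exact enorm_indicator_le_enorm_self _ _

end Bridge

/-! ### Squared form of the two estimates -/

section Squared

variable {d : ℕ} {α γ s : ℝ}

theorem le_two_pi_pow_mul_sq (d : ℕ) {B : ℝ} (hB : 0 ≤ B) :
    B ≤ (2 * Real.pi) ^ d * (Real.sqrt B + 1) ^ 2 := by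
  have h1 : 1 ≤ (2 * Real.pi) ^ d := one_le_pow₀ (by linarith [Real.pi_gt_three])
  have h2 : B ≤ (Real.sqrt B + 1) ^ 2 := by
    nlinarith [Real.sq_sqrt hB, Real.sqrt_nonneg B]
  nlinarith [sq_nonneg (Real.sqrt B + 1)]

theorem rpow_sq {x : ℝ} (hx : 0 ≤ x) (p : ℝ) : (x ^ p) ^ 2 = x ^ (2 * p) := by
  rw [← Real.rpow_natCast, ← Real.rpow_mul hx]
  congr 1
  push_cast
  ring

/-- The constant in `MaximalEstimate` after squaring. -/
theorem sq_maximal_const {R D : ℝ} (hR : 1 ≤ R) (hD : 0 ≤ D) (C γ s δ : ℝ) :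
    (C * R ^ ((δ - γ) / 2 + s) * D ^ (1 / 2 : ℝ)) ^ 2 = C ^ 2 * (R ^ (δ - γ + 2 * s) * D) := by
  rw [mul_pow, mul_pow, rpow_sq (x := R) (by linarith), rpow_sq hD]
  have e1 : 2 * ((δ - γ) / 2 + s) = δ - γ + 2 * s := by ring
  rw [e1]
  norm_num
  ring

theorem sq_localized_const {R D N : ℝ} (hR : 1 ≤ R) (hD : 0 ≤ D) (hN : 0 ≤ N) (C γ p δ : ℝ) :
    (C * D ^ (1 / 2 : ℝ) * R ^ ((δ - γ) / 2) * N ^ p) ^ 2 =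
      C ^ 2 * (R ^ (δ - γ) * N ^ (2 * p) * D) := by
  rw [mul_pow, mul_pow, mul_pow, rpow_sq (x := R) (by linarith), rpow_sq hD, rpow_sq hN]
  have e1 : 2 * ((δ - γ) / 2) = δ - γ := by ring
  rw [e1]
  norm_num
  ring

theorem maximalEstimate_iff : MaximalEstimate d α γ s ↔
    ∃ C : ℝ, 0 ≤ C ∧ ∀ R : ℝ, 1 ≤ R → ∀ (μ : Measure (Space d)) (A : ℝ≥0), BallBound γ μ A →
      MaxBound α (Ioc 0 1) (μ.restrict (Metric.ball 0 1)) R (2 * R)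
        (ENNReal.ofReal (C * (R ^ ((d : ℝ) - γ + 2 * s) * A))) := by
  constructor
  · rintro ⟨C, hC, h⟩
    refine ⟨(2 * Real.pi) ^ d * C ^ 2, by positivity, fun R hR μ A hA => ?_⟩
    have hR0 : 0 < R := by linarith
    have h1 := (maximalNorm_le_iff_maxBound (by positivity)).1 (h R hR μ ⟨A, hA⟩)
    refine h1.mono subset_rfl le_rfl le_rfl le_rfl (ENNReal.ofReal_le_ofReal ?_)
    rw [sq_maximal_const hR NNReal.zero_le_coe, mul_assoc]
    have := dimConst_le hA
    gcongr
  · rintro ⟨B, hB, h⟩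
    refine ⟨Real.sqrt B + 1, by positivity, fun R hR μ hμ => ?_⟩
    have hR0 : 0 < R := by linarith
    refine (maximalNorm_le_iff_maxBound (by positivity)).2 ?_
    refine (h R hR μ _ (ballBound_dimConst hμ)).mono subset_rfl le_rfl le_rfl le_rfl
      (ENNReal.ofReal_le_ofReal ?_)
    rw [sq_maximal_const hR NNReal.zero_le_coe, ← mul_assoc ((2 * Real.pi) ^ d)]
    gcongr
    exact le_two_pi_pow_mul_sq d hB

theorem localizedBound_iff {R C : ℝ} (hR : 1 ≤ R) (hC : 0 ≤ C) (I : Set ℝ)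
    (μ : Measure (Space d)) : LocalizedBound α γ s C R I μ ↔
      MaxBound α I (μ.restrict (Metric.ball 0 1)) R (2 * R)
        (ENNReal.ofReal ((2 * Real.pi) ^ d * C ^ 2 * (R ^ ((d : ℝ) - γ) *
          (1 + R ^ α * volume.real I) ^ (2 * max s (s / α)) * dimConst γ μ))) := by
  have hR0 : 0 < R := by linarith
  have hN : 0 ≤ 1 + R ^ α * volume.real I := by positivity
  rw [mul_assoc ((2 * Real.pi) ^ d), ← sq_localized_const hR NNReal.zero_le_coe hN]
  exact maximalNorm_le_iff_maxBound (by positivity)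

end Squared

/-! ### From the global to the localized estimate -/

section GlobalToLocal

variable {d : ℕ} {α γ s : ℝ}

theorem sub_sInf_le_volume {I : Set ℝ} (hI : I.OrdConnected) (hI1 : I ⊆ Icc 0 1) {t : ℝ}
    (ht : t ∈ I) : 0 ≤ t - sInf I ∧ t - sInf I ≤ volume.real I := by
  have hbdd : BddBelow I := ⟨0, fun u hu => (hI1 hu).1⟩
  refine ⟨sub_nonneg.2 (csInf_le hbdd ht), ?_⟩
  have hfin : volume I ≠ ∞ := ((measure_mono hI1).trans_lt (by simp)).ne
  have h : t - volume.real I ≤ sInf I := by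
    refine le_csInf ⟨t, ht⟩ fun u hu => ?_
    rcases le_total t u with htu | htu
    · linarith [measureReal_nonneg (μ := volume) (s := I)]
    · have h1 : volume.real (Icc u t) ≤ volume.real I := measureReal_mono (hI.out hu ht) hfin
      rw [Real.volume_real_Icc_of_le htu] at h1
      linarith
  linarith

/-- The maximal estimate at the frequencies `M`, on unit balls and at unit time, gives an estimate
without spatial localization for the times `0 < t ≤ T`, provided that waves travel at most the
distance one in time `T`. -/
theorem exists_maxBound_global (d : ℕ) {α p B : ℝ} (hα : 0 < α) (hB : 0 ≤ B) :
    ∃ C : ℝ, 0 ≤ C ∧ ∀ (γ M T : ℝ) (μ : Measure (Space d)) (A : ℝ≥0),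
      (∀ R : ℝ, 1 ≤ R → ∀ μ : Measure (Space d), BallBound γ μ A →
        MaxBound α (Ioc 0 1) (μ.restrict (Metric.ball 0 1)) R (2 * R)
          (ENNReal.ofReal (B * (R ^ p * A)))) →
      2 ≤ M → 0 ≤ T → T ≤ 1 → T * M ^ (α - 1) ≤ 1 → BallBound γ μ A →
      MaxBound α (Ioc 0 T) μ M (2 * M) (ENNReal.ofReal (C * (M ^ p * A))) := by
  set κ : ℝ := α * (2 ^ |α - 1| * 2 ^ |α - 1|) with hκ
  obtain ⟨Cl, hClt, hCl⟩ := exists_maxBound_of_balls d (κ := κ) (by positivity)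
  refine ⟨4 * Cl.toReal * (B * 2 ^ |p|), by positivity, ?_⟩
  intro γ M T μ A h hM hT0 hT1 hTM hμ
  have hM0 : 0 < M := by linarith
  set K := Cl * ENNReal.ofReal (B * (2 ^ |p| * M ^ p * A)) with hK
  have band : ∀ m : ℝ, M ≤ m → m ≤ 3 / 2 * M → MaxBound α (Ioc 0 T) μ m (3 / 2 * m) K := by
    intro m h1 h2
    have hm : 1 ≤ m := by linarith
    refine hCl α m (3 / 2 * m) _ (Ioc 0 T) μ _ hμ.sFinite (slowSymbol d hα hm) ?_ ?_
    · intro t ht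
      have h3 : m ^ (α - 1) ≤ 2 ^ |α - 1| * M ^ (α - 1) :=
        rpow_le_mul_rpow (by norm_num) hM0 (by linarith) (by linarith) _
      rw [abs_of_pos ht.1]
      calc t * (α * (2 ^ |α - 1| * m ^ (α - 1)))
          ≤ T * (α * (2 ^ |α - 1| * (2 ^ |α - 1| * M ^ (α - 1)))) := by
            have := ht.2
            gcongr
        _ = κ * (T * M ^ (α - 1)) := by rw [hκ]; ring
        _ ≤ κ * 1 := by gcongr
        _ = κ := mul_one κ
    · intro x₀
      have h4 := (h (m - 1 / 4) (by linarith) _ (hμ.map_sub x₀)).translate_space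
      refine h4.mono (Ioc_subset_Ioc_right hT1) le_rfl le_rfl (by linarith)
        (ENNReal.ofReal_le_ofReal ?_)
      have h5 : (m - 1 / 4) ^ p ≤ 2 ^ |p| * M ^ p :=
        rpow_le_mul_rpow (by norm_num) hM0 (by linarith) (by linarith) _
      gcongr
  have hu := (band M le_rfl (by linarith)).union (band (3 / 2 * M) (by linarith) le_rfl)
  refine hu.mono subset_rfl le_rfl le_rfl (by linarith) (le_of_eq ?_)
  rw [hK]
  nth_rewrite 1 2 [← ENNReal.ofReal_toReal hClt]
  rw [← ENNReal.ofReal_mul ENNReal.toReal_nonneg, ← ENNReal.ofReal_add (by positivity)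
    (by positivity), ← ENNReal.ofReal_ofNat 2, ← ENNReal.ofReal_mul (by norm_num)]
  congr 1
  ring

theorem exists_localizedBound_of_maximalEstimate (hα : 0 < α) (h : MaximalEstimate d α γ s) :
    ∃ C' : ℝ, 0 < C' ∧ ∀ R : ℝ, 1 ≤ R → ∀ I : Set ℝ, I.OrdConnected → I ⊆ Icc 0 1 →
      ∀ μ : Measure (Space d), IsDimensional γ μ → LocalizedBound α γ s C' R I μ := by
  obtain ⟨B, hB, h⟩ := maximalEstimate_iff.1 h
  set p : ℝ := (d : ℝ) - γ + 2 * s with hp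
  obtain ⟨C, hC, hglob⟩ := exists_maxBound_global d (p := p) hα hB
  set B' : ℝ := C * 2 ^ (2 * s) with hB'
  have hB'0 : 0 ≤ B' := by positivity
  refine ⟨Real.sqrt B' + 1, by positivity, fun R hR I hI hI1 μ hμ => ?_⟩
  rw [localizedBound_iff hR (by positivity)]
  have hR0 : 0 < R := by linarith
  set ℓ := volume.real I with hℓ
  have hℓ0 : 0 ≤ ℓ := measureReal_nonneg
  set N := 1 + R ^ α * ℓ with hN
  have hN1 : 1 ≤ N := by
    have : 0 ≤ R ^ α * ℓ := by positivity
    linarith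
  have hN0 : 0 < N := by linarith
  -- `M` is the frequency after rescaling: the rescaled interval has length at most `1`, and
  -- waves of frequency `M` travel at most the distance `1` in this time
  set e : ℝ := max 1 (1 / α) with he
  set M := 2 * N ^ e with hM
  have hNe : 1 ≤ N ^ e := Real.one_le_rpow hN1 (le_trans zero_le_one (le_max_left _ _))
  have hM2 : 2 ≤ M := by linarith
  have hM0 : 0 < M := by linarith
  have hNM : N ≤ M := by
    have : N ^ (1 : ℝ) ≤ N ^ e := Real.rpow_le_rpow_of_exponent_le hN1 (le_max_left _ _)
    rw [Real.rpow_one] at this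
    linarith
  have hNMα : N ≤ M ^ α := by
    have h1 : N ^ (1 / α) ≤ M :=
      (Real.rpow_le_rpow_of_exponent_le hN1 (le_max_right _ _)).trans (by linarith)
    have h2 := Real.rpow_le_rpow (by positivity) h1 hα.le
    rwa [← Real.rpow_mul hN0.le, one_div_mul_cancel hα.ne', Real.rpow_one] at h2
  set ρ := M / R with hρ
  have hρ0 : 0 < ρ := by positivity
  set T := N * M ^ (-α) with hT
  have hT0 : 0 ≤ T := by positivity
  have hT1 : T ≤ 1 := by
    rw [hT, Real.rpow_neg hM0.le, ← div_eq_mul_inv, div_le_one (by positivity)]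
    exact hNMα
  have hTM : T * M ^ (α - 1) ≤ 1 := by
    rw [hT, mul_assoc, ← Real.rpow_add hM0]
    have : -α + (α - 1) = -1 := by ring
    rw [this, Real.rpow_neg_one, ← div_eq_mul_inv, div_le_one hM0]
    exact hNM
  set D := dimConst γ μ with hD
  have hμD := (ballBound_dimConst hμ).map_smul hρ0
  have h1 := hglob γ M T _ _ (fun R hR μ hμ => h R hR μ _ hμ) hM2 hT0 hT1 hTM hμD
  have e1 : ρ * R = M := div_mul_cancel₀ _ hR0.ne'
  have e2 : ρ * (2 * R) = 2 * M := by rw [← e1]; ring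
  rw [← e2, ← e1] at h1
  have h2 := h1.rescale (S := Ioc 0 (R ^ (-α) + ℓ)) hρ0 (by
    intro t ht
    refine ⟨mul_pos ht.1 (by positivity), ?_⟩
    have h3 : T = (R ^ (-α) + ℓ) * ρ ^ (-α) := by
      have : R ^ (-α) + ℓ = N * R ^ (-α) := by
        rw [hN, add_mul, mul_right_comm, ← Real.rpow_add hR0]
        simp
      rw [this, hT, mul_assoc, ← Real.mul_rpow hR0.le hρ0.le, mul_comm R, e1]
    rw [h3]
    have := ht.2
    gcongr)
  have h3 := h2.translate_time (S := I) (sInf I - R ^ (-α)) (by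
    intro t ht
    have h4 := sub_sInf_le_volume hI hI1 ht
    have h5 : 0 < R ^ (-α) := by positivity
    constructor <;> linarith)
  refine h3.mono subset_rfl Measure.restrict_le_self le_rfl le_rfl ?_
  rw [← ENNReal.ofReal_inv_of_pos (by positivity), ← ENNReal.ofReal_mul (by positivity)]
  refine ENNReal.ofReal_le_ofReal ?_
  have e3 : (ρ ^ d)⁻¹ * (C * (M ^ p * (D * ρ ^ γ))) = C * (R ^ ((d : ℝ) - γ) * M ^ (2 * s) * D) := by
    have h4 : (ρ ^ d)⁻¹ * ρ ^ γ = M ^ (γ - d) * R ^ ((d : ℝ) - γ) := by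
      rw [← Real.rpow_natCast, ← Real.rpow_neg hρ0.le, ← Real.rpow_add hρ0, hρ,
        Real.div_rpow hM0.le hR0.le, div_eq_mul_inv, ← Real.rpow_neg hR0.le]
      congr 2 <;> ring
    have h5 : M ^ p * M ^ (γ - d) = M ^ (2 * s) := by
      rw [← Real.rpow_add hM0, hp]
      congr 1
      ring
    calc _ = C * D * M ^ p * ((ρ ^ d)⁻¹ * ρ ^ γ) := by ring
      _ = C * D * (M ^ p * M ^ (γ - d)) * R ^ ((d : ℝ) - γ) := by rw [h4]; ring
      _ = _ := by rw [h5]; ring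
  have e4 : M ^ (2 * s) ≤ 2 ^ (2 * s) * N ^ (2 * max s (s / α)) := by
    rw [hM, Real.mul_rpow (by norm_num) (by positivity), ← Real.rpow_mul hN0.le]
    have : e * (2 * s) ≤ 2 * max s (s / α) := by
      rcases max_choice 1 (1 / α) with h6 | h6
      · rw [he, h6, one_mul]
        exact mul_le_mul_of_nonneg_left (le_max_left _ _) (by norm_num)
      · have h7 : 1 / α * (2 * s) = 2 * (s / α) := by ring
        rw [he, h6, h7]
        exact mul_le_mul_of_nonneg_left (le_max_right _ _) (by norm_num)
    gcongr
  have e5 : ((D * (ρ ^ γ).toNNReal : ℝ≥0) : ℝ) = D * ρ ^ γ := by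
    rw [NNReal.coe_mul, Real.coe_toNNReal _ (by positivity)]
  rw [e1, e5, e3]
  calc C * (R ^ ((d : ℝ) - γ) * M ^ (2 * s) * D)
      ≤ C * (R ^ ((d : ℝ) - γ) * (2 ^ (2 * s) * N ^ (2 * max s (s / α))) * D) := by gcongr
    _ = B' * (R ^ ((d : ℝ) - γ) * N ^ (2 * max s (s / α)) * D) := by rw [hB']; ring
    _ ≤ _ := by
        gcongr
        exact le_two_pi_pow_mul_sq d hB'0

end GlobalToLocal

/-! ### Uniformity in the measure -/

section Uniformity

variable {d : ℕ} {α γ s a b : ℝ} {S : Set ℝ} {μ : Measure (Space d)} {K : ℝ≥0∞}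

theorem MaxBound.smul_restrict {B : Set (Space d)} (h : MaxBound α S (μ.restrict B) a b K)
    (c : ℝ≥0∞) : MaxBound α S ((c • μ).restrict B) a b (c * K) := by
  intro g hg
  have : maxEnergy α S ((c • μ).restrict B) g = c * maxEnergy α S (μ.restrict B) g := by
    rw [maxEnergy, Measure.restrict_smul, lintegral_smul_measure]
    rfl
  rw [this, mul_assoc]
  exact mul_le_mul' le_rfl (h g hg)

theorem MaxBound.of_measure_eq_zero (h : μ (Metric.ball 0 1) = 0) :
    MaxBound α S (μ.restrict (Metric.ball 0 1)) a b K := by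
  intro g _
  simp [maxEnergy, Measure.restrict_eq_zero.2 h]

/-- Sliding hump: if each `γ`-dimensional measure admits some constant, then the constant may be
chosen proportional to the dimensional constant of the measure. Otherwise a weighted sum of
measures with bad constants would admit no constant. -/
theorem exists_uniform_maxBound (S : ℝ → Set ℝ) (w : ℝ → ℝ) (hw : ∀ R, 1 < R → 0 ≤ w R)
    (H : ∀ μ : Measure (Space d), IsDimensional γ μ → ∃ B : ℝ, ∀ R : ℝ, 1 < R →
      MaxBound α (S R) (μ.restrict (Metric.ball 0 1)) R (2 * R) (ENNReal.ofReal (B * w R))) :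
    ∃ B : ℝ, 0 ≤ B ∧ ∀ R : ℝ, 1 < R → ∀ (μ : Measure (Space d)) (A : ℝ≥0), BallBound γ μ A →
      MaxBound α (S R) (μ.restrict (Metric.ball 0 1)) R (2 * R)
        (ENNReal.ofReal (B * (w R * A))) := by
  have key : ∃ j : ℕ, ∀ R : ℝ, 1 < R → ∀ μ : Measure (Space d), BallBound γ μ 1 →
      MaxBound α (S R) (μ.restrict (Metric.ball 0 1)) R (2 * R)
        (ENNReal.ofReal (4 ^ j * w R)) := by
    by_contra! hcon
    choose R hR μ hμ hbad using hcon
    set c : ℕ → ℝ≥0∞ := fun j => 2⁻¹ ^ (j + 1) with hc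
    set ν : Measure (Space d) := Measure.sum fun j => c j • μ j with hν
    have hνb : BallBound γ ν 1 := by
      intro x r hr
      rw [hν, Measure.sum_apply _ Metric.isOpen_ball.measurableSet]
      calc ∑' j, (c j • μ j) (Metric.ball x r)
          ≤ ∑' j, c j * ((1 : ℝ≥0) * ENNReal.ofReal (r ^ γ)) := by
            refine ENNReal.tsum_le_tsum fun j => ?_
            rw [Measure.smul_apply, smul_eq_mul]
            exact mul_le_mul' le_rfl (hμ j x r hr)
        _ = (1 : ℝ≥0) * ENNReal.ofReal (r ^ γ) := by
            rw [ENNReal.tsum_mul_right, hc, ENNReal.tsum_geometric_add_one,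
              ENNReal.one_sub_inv_two, inv_inv, ENNReal.inv_mul_cancel (by norm_num) (by norm_num),
              one_mul]
    obtain ⟨B, hB⟩ := H ν ⟨1, hνb⟩
    obtain ⟨j, hj⟩ := pow_unbounded_of_one_lt (2 * B) (by norm_num : (1 : ℝ) < 2)
    have hcj : (2 : ℝ≥0∞) ^ (j + 1) * c j = 1 := by
      rw [hc]
      simp only
      rw [← mul_pow, ENNReal.mul_inv_cancel (by norm_num) (by norm_num), one_pow]
    have h1 := (hB (R j) (hR j)).mono subset_rfl (Measure.restrict_mono_measure
      (Measure.le_sum (fun j => c j • μ j) j) _) le_rfl le_rfl le_rfl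
    have h2 := h1.smul_restrict (2 ^ (j + 1))
    rw [smul_smul, hcj, one_smul] at h2
    refine hbad j (h2.mono subset_rfl le_rfl le_rfl le_rfl ?_)
    rw [show (2 : ℝ≥0∞) ^ (j + 1) = ENNReal.ofReal (2 ^ (j + 1)) by
      rw [ENNReal.ofReal_pow (by norm_num)]; norm_num, ← ENNReal.ofReal_mul (by positivity)]
    refine ENNReal.ofReal_le_ofReal ?_
    have h3 : (2 : ℝ) ^ (j + 1) * B ≤ 4 ^ j := by
      have : (4 : ℝ) ^ j = 2 ^ j * 2 ^ j := by rw [← mul_pow]; norm_num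
      rw [this, pow_succ]
      have : (0 : ℝ) < 2 ^ j := by positivity
      nlinarith
    have := hw (R j) (hR j)
    nlinarith
  obtain ⟨j, hj⟩ := key
  refine ⟨4 ^ j, by positivity, fun R hR μ A hA => ?_⟩
  rcases eq_or_ne A 0 with rfl | hA0
  · refine MaxBound.of_measure_eq_zero ?_
    simpa using hA 0 1 one_pos
  · have hA0' : (A : ℝ≥0∞) ≠ 0 := by exact_mod_cast hA0
    have h1 : BallBound γ ((A : ℝ≥0∞)⁻¹ • μ) 1 := by
      intro x r hr
      rw [Measure.smul_apply, smul_eq_mul, ENNReal.coe_one, one_mul]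
      calc (A : ℝ≥0∞)⁻¹ * μ (Metric.ball x r)
          ≤ (A : ℝ≥0∞)⁻¹ * (A * ENNReal.ofReal (r ^ γ)) := mul_le_mul' le_rfl (hA x r hr)
        _ = ENNReal.ofReal (r ^ γ) := by
            rw [← mul_assoc, ENNReal.inv_mul_cancel hA0' ENNReal.coe_ne_top, one_mul]
    have h2 := (hj R hR _ h1).smul_restrict A
    rw [smul_smul, ENNReal.mul_inv_cancel hA0' ENNReal.coe_ne_top, one_smul] at h2
    refine h2.mono subset_rfl le_rfl le_rfl le_rfl (le_of_eq ?_)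
    rw [← ENNReal.ofReal_coe_nnreal, ← ENNReal.ofReal_mul A.coe_nonneg]
    congr 1
    ring

end Uniformity

/-! ### From the localized to the global estimate -/

section LocalToGlobal

variable {d : ℕ} {α γ s a b : ℝ} {S : Set ℝ} {μ : Measure (Space d)}

/-- At bounded frequencies the evolution is bounded by the Cauchy–Schwarz inequality. -/
theorem maxBound_of_bounded_frequency {A : ℝ≥0} (hA : BallBound γ μ A) :
    MaxBound α S (μ.restrict (Metric.ball 0 1)) a b
      (volume (Metric.closedBall (0 : Space d) b) * A) := by
  intro g hg
  have h1 : (∫⁻ ξ, ‖g ξ‖ₑ) ^ 2 ≤ volume (Metric.closedBall (0 : Space d) b) * energy g := by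
    have h2 : ∫⁻ ξ, ‖g ξ‖ₑ = ∫⁻ ξ in Metric.closedBall 0 b, ‖g ξ‖ₑ := by
      rw [← lintegral_indicator Metric.isClosed_closedBall.measurableSet]
      refine lintegral_congr fun ξ => ?_
      by_cases h0 : g ξ = 0
      · simp [Set.indicator, h0]
      · rw [indicator_of_mem (mem_closedBall_zero_iff.2 (hg.supp ξ h0).2)]
    rw [h2]
    refine (sq_lintegral_le _ hg.measurable.enorm.aemeasurable).trans ?_
    rw [Measure.restrict_apply_univ]
    exact mul_le_mul' le_rfl (setLIntegral_le_lintegral _ _)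
  have h3 : μ (Metric.ball 0 1) ≤ A := by simpa using hA 0 1 one_pos
  calc maxEnergy α S (μ.restrict (Metric.ball 0 1)) g
      ≤ ∫⁻ _, (∫⁻ ξ, ‖g ξ‖ₑ) ^ 2 ∂(μ.restrict (Metric.ball 0 1)) := by
        refine lintegral_mono fun x => pow_le_pow_left₀ (by positivity) ?_ 2
        exact iSup₂_le fun t _ => enorm_evolution_le t x
    _ = (∫⁻ ξ, ‖g ξ‖ₑ) ^ 2 * μ (Metric.ball 0 1) := by simp
    _ ≤ volume (Metric.closedBall (0 : Space d) b) * energy g * A := mul_le_mul' h1 h3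
    _ = _ := by ring

/-- The normalized Lebesgue measure on a ball of radius `1/(2R)` is `γ`-dimensional, uniformly in
`R`. -/
theorem ballBound_smallBall (hγ : 0 < γ) (hγd : γ ≤ d) {R : ℝ} (hR : 1 ≤ R) :
    BallBound γ (ENNReal.ofReal (R ^ ((d : ℝ) - γ)) •
        (volume : Measure (Space d)).restrict (Metric.ball 0 (1 / (2 * R))))
      (volume (Metric.ball (0 : Space d) 1)).toNNReal := by
  have hR0 : 0 < R := by linarith
  intro x r hr
  rw [Measure.smul_apply, smul_eq_mul, Measure.restrict_apply Metric.isOpen_ball.measurableSet,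
    ENNReal.coe_toNNReal measure_ball_lt_top.ne]
  set v := volume (Metric.ball (0 : Space d) 1) with hv
  have h1 : volume (Metric.ball x r) = ENNReal.ofReal (r ^ d) * v := by
    rw [Measure.addHaar_ball_of_pos _ _ hr, finrank_euclideanSpace_fin]
  have h2 : volume (Metric.ball (0 : Space d) (1 / (2 * R))) =
      ENNReal.ofReal ((1 / (2 * R)) ^ d) * v := by
    rw [Measure.addHaar_ball_of_pos _ _ (by positivity), finrank_euclideanSpace_fin]
  have main : ∀ t : ℝ, 0 ≤ t → R ^ ((d : ℝ) - γ) * t ≤ r ^ γ →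
      volume (Metric.ball x r ∩ Metric.ball 0 (1 / (2 * R))) ≤ ENNReal.ofReal t * v →
      ENNReal.ofReal (R ^ ((d : ℝ) - γ)) *
        volume (Metric.ball x r ∩ Metric.ball 0 (1 / (2 * R))) ≤ v * ENNReal.ofReal (r ^ γ) := by
    intro t ht h3 h4
    calc _ ≤ ENNReal.ofReal (R ^ ((d : ℝ) - γ)) * (ENNReal.ofReal t * v) := mul_le_mul' le_rfl h4
      _ = v * ENNReal.ofReal (R ^ ((d : ℝ) - γ) * t) := by
          rw [ENNReal.ofReal_mul (by positivity)]; ring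
      _ ≤ _ := by gcongr
  rcases le_total (r * R) 1 with hrR | hrR
  · refine main (r ^ d) (by positivity) ?_ ((measure_mono inter_subset_left).trans_eq h1)
    calc R ^ ((d : ℝ) - γ) * r ^ d = (r * R) ^ ((d : ℝ) - γ) * r ^ γ := by
          rw [Real.mul_rpow hr.le hR0.le, mul_right_comm, ← Real.rpow_add hr, sub_add_cancel,
            Real.rpow_natCast, mul_comm]
      _ ≤ 1 * r ^ γ := by
          gcongr
          exact Real.rpow_le_one (by positivity) hrR (by linarith)
      _ = r ^ γ := one_mul _
  · refine main ((1 / (2 * R)) ^ d) (by positivity) ?_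
      ((measure_mono inter_subset_right).trans_eq h2)
    calc R ^ ((d : ℝ) - γ) * (1 / (2 * R)) ^ d ≤ R ^ ((d : ℝ) - γ) * (1 / R) ^ d := by
          gcongr
          linarith
      _ = (1 / R) ^ γ := by
          rw [← Real.rpow_natCast (1 / R), one_div, Real.inv_rpow hR0.le, Real.inv_rpow hR0.le,
            ← Real.rpow_neg hR0.le, ← Real.rpow_neg hR0.le, ← Real.rpow_add hR0]
          congr 1
          ring
      _ ≤ r ^ γ := by
          refine Real.rpow_le_rpow (by positivity) ?_ hγ.le
          rwa [div_le_iff₀ hR0]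

/-- A lower bound for the constant of any maximal inequality including the time `0`, from a
function focusing on the ball of radius `1/(2R)`. -/
theorem le_of_maxBound_smallBall (hd : 0 < d) {R B : ℝ} (hR : 1 ≤ R) (hB : 0 ≤ B) (h0 : 0 ∈ S)
    (h : MaxBound α S ((ENNReal.ofReal (R ^ ((d : ℝ) - γ)) •
        (volume : Measure (Space d)).restrict (Metric.ball 0 (1 / (2 * R)))).restrict
          (Metric.ball 0 1)) R (2 * R) (ENNReal.ofReal B)) :
    R ^ ((d : ℝ) - γ) * volume.real (Metric.ball (0 : Space d) 1) ^ 2 ≤ 4 ^ (d + 1) * B := by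
  have hR0 : 0 < R := by linarith
  set x₀ : Space d := EuclideanSpace.single ⟨0, hd⟩ (3 / 2 * R) with hx₀
  have hx₀n : ‖x₀‖ = 3 / 2 * R := by
    rw [hx₀, PiLp.norm_single, Real.norm_eq_abs, abs_of_pos (by positivity)]
  set A : Set (Space d) := Metric.ball x₀ (R / 2) with hA
  have hAm : MeasurableSet A := Metric.isOpen_ball.measurableSet
  have hAn : ∀ ξ ∈ A, R ≤ ‖ξ‖ ∧ ‖ξ‖ ≤ 2 * R := by
    intro ξ hξ
    have h1 : ‖ξ - x₀‖ < R / 2 := by simpa [hA, dist_eq_norm] using hξ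
    have h2 := norm_sub_norm_le ξ x₀
    have h3 := norm_sub_norm_le x₀ ξ
    rw [norm_sub_rev] at h3
    constructor <;> linarith
  set v := volume.real (Metric.ball (0 : Space d) 1) with hv
  have hball : ∀ (x : Space d) (r : ℝ), 0 < r →
      volume (Metric.ball x r) = ENNReal.ofReal (r ^ d * v) := by
    intro x r hr
    rw [Measure.addHaar_ball_of_pos _ _ hr, finrank_euclideanSpace_fin,
      ENNReal.ofReal_mul (by positivity), hv, ofReal_measureReal measure_ball_lt_top.ne]
  have hv0 : 0 < v := by
    rw [hv]
    exact ENNReal.toReal_pos (Metric.measure_ball_pos _ _ one_pos).ne' measure_ball_lt_top.ne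
  set V : ℝ := (R / 2) ^ d * v with hV
  have hV0 : 0 < V := by positivity
  have hvolA : volume A = ENNReal.ofReal V := hball x₀ _ (by positivity)
  have hAfin : IsFiniteMeasure (volume.restrict A) := ⟨by simp [hvolA]⟩
  set g : Space d → ℂ := A.indicator 1 with hg
  have hgE : energy g = ENNReal.ofReal V := by
    rw [← hvolA, ← setLIntegral_one, ← lintegral_indicator hAm, energy]
    refine lintegral_congr fun ξ => ?_
    by_cases hξ : ξ ∈ A
    · simp [hg, hξ]
    · simp [hg, hξ]
  have hgB : Band R (2 * R) g := by
    refine ⟨measurable_one.indicator hAm, fun ξ hξ => hAn ξ (Set.mem_of_indicator_ne_zero hξ), ?_⟩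
    rw [hgE]
    exact ENNReal.ofReal_lt_top
  have hlow : ∀ x ∈ Metric.ball (0 : Space d) (1 / (2 * R)),
      ENNReal.ofReal (V / 2) ≤ ‖evolution α 0 g x‖ₑ := by
    intro x hx
    have hx1 : ‖x‖ < 1 / (2 * R) := by simpa using hx
    have h1 : evolution α 0 g x = ∫ ξ in A, Complex.exp (Complex.I * ((inner ℝ x ξ : ℝ) : ℂ)) := by
      rw [evolution, ← integral_indicator hAm]
      refine integral_congr_ae (.of_forall fun ξ => ?_)
      by_cases hξ : ξ ∈ A
      · simp [hg, hξ]
      · simp [hg, hξ]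
    have h2 := half_le_norm_integral_phase (volume.restrict A) (φ := fun ξ => inner ℝ x ξ)
      (by fun_prop) (by
        filter_upwards [ae_restrict_mem hAm] with ξ hξ
        refine (abs_real_inner_le_norm x ξ).trans ?_
        have h3 := (hAn ξ hξ).2
        calc ‖x‖ * ‖ξ‖ ≤ 1 / (2 * R) * (2 * R) := by gcongr
          _ = 1 := one_div_mul_cancel (by positivity))
    have h4 : (volume.restrict A).real univ = V := by
      rw [Measure.real, Measure.restrict_apply_univ, hvolA, ENNReal.toReal_ofReal hV0.le]
    rw [h4, ← h1] at h2
    rw [← ofReal_norm]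
    exact ENNReal.ofReal_le_ofReal h2
  have hsub : Metric.ball (0 : Space d) (1 / (2 * R)) ⊆ Metric.ball 0 1 := by
    refine Metric.ball_subset_ball ?_
    rw [div_le_one (by positivity)]
    linarith
  set w : ℝ := R ^ ((d : ℝ) - γ) with hw
  have hw0 : 0 < w := by positivity
  have hmain := h g hgB
  have hge : ENNReal.ofReal ((V / 2) ^ 2 * (w * ((1 / (2 * R)) ^ d * v))) ≤
      maxEnergy α S ((ENNReal.ofReal w •
        (volume : Measure (Space d)).restrict (Metric.ball 0 (1 / (2 * R)))).restrict
          (Metric.ball 0 1)) g := by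
    rw [Measure.restrict_smul, Measure.restrict_restrict Metric.isOpen_ball.measurableSet,
      inter_eq_self_of_subset_right hsub, maxEnergy, lintegral_smul_measure, smul_eq_mul]
    calc _ = ENNReal.ofReal w *
          ∫⁻ _ in Metric.ball (0 : Space d) (1 / (2 * R)), ENNReal.ofReal (V / 2) ^ 2 := by
          rw [setLIntegral_const, hball _ _ (by positivity), ← ENNReal.ofReal_pow (by positivity),
            ← ENNReal.ofReal_mul (by positivity), ← ENNReal.ofReal_mul (by positivity)]
          congr 1
          ring
      _ ≤ _ := by
          refine mul_le_mul' le_rfl (setLIntegral_mono' Metric.isOpen_ball.measurableSet ?_)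
          intro x hx
          refine pow_le_pow_left₀ (by positivity) ((hlow x hx).trans ?_) 2
          exact le_biSup (fun t => ‖evolution α t g x‖ₑ) h0
  have hfin := hge.trans hmain
  rw [hgE, ← ENNReal.ofReal_mul hB, ENNReal.ofReal_le_ofReal_iff (by positivity)] at hfin
  have e1 : (R / 2) ^ d * (1 / (2 * R)) ^ d * 4 ^ d = 1 := by
    rw [← mul_pow, ← mul_pow]
    have : R / 2 * (1 / (2 * R)) * 4 = 1 := by field_simp; norm_num
    rw [this, one_pow]
  have e2 : V * (V * (w * ((1 / (2 * R)) ^ d * v))) ≤ V * (4 * B) := by linarith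
  have e3 := le_of_mul_le_mul_left e2 hV0
  calc w * v ^ 2 = ((R / 2) ^ d * (1 / (2 * R)) ^ d * 4 ^ d) * (w * v ^ 2) := by rw [e1, one_mul]
    _ = 4 ^ d * (V * (w * ((1 / (2 * R)) ^ d * v))) := by rw [hV]; ring
    _ ≤ 4 ^ d * (4 * B) := by gcongr
    _ = 4 ^ (d + 1) * B := by ring

end LocalToGlobal

section Converse

variable {d : ℕ} {α γ s : ℝ}

/-- The longest admissible time interval at frequency `R` in the localized estimate. -/
noncomputable def maxTime (α R : ℝ) : ℝ := min (R ^ (1 - α)) 1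

theorem maxTime_pos {R : ℝ} (α : ℝ) (hR : 1 ≤ R) : 0 < maxTime α R :=
  lt_min (Real.rpow_pos_of_pos (by linarith) _) one_pos

theorem rpow_mul_maxTime {R : ℝ} (hR : 1 ≤ R) (α : ℝ) :
    R ^ α * maxTime α R = R ^ (min 1 α) := by
  have hR0 : 0 < R := by linarith
  rw [maxTime, mul_min_of_nonneg _ _ (by positivity), ← Real.rpow_add hR0, mul_one]
  have : α + (1 - α) = 1 := by ring
  rw [this]
  rcases le_total 1 α with h | h
  · rw [min_eq_left h, min_eq_left (Real.rpow_le_rpow_of_exponent_le hR h)]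
  · rw [min_eq_right h, min_eq_right (Real.rpow_le_rpow_of_exponent_le hR h)]

/-- The squared constant of the localized estimate on an interval of maximal length. -/
noncomputable def timeWeight (d : ℕ) (α γ s R : ℝ) : ℝ :=
  R ^ ((d : ℝ) - γ) * (1 + R ^ α * maxTime α R) ^ (2 * max s (s / α))

theorem timeWeight_nonneg {R : ℝ} (hR : 1 ≤ R) : 0 ≤ timeWeight d α γ s R := by
  have := maxTime_pos α hR
  unfold timeWeight
  positivity

theorem min_mul_max (hα : 0 < α) (hs : 0 ≤ s) : min 1 α * max s (s / α) = s := by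
  rcases le_total 1 α with h | h
  · rw [min_eq_left h, max_eq_left (div_le_self hs h), one_mul]
  · rw [min_eq_right h, max_eq_right (by rw [le_div_iff₀ hα]; nlinarith)]
    field_simp

theorem timeWeight_le {R : ℝ} (hα : 0 < α) (hs : 0 ≤ s) (hR : 1 ≤ R) :
    timeWeight d α γ s R ≤ 2 ^ (2 * max s (s / α)) * R ^ ((d : ℝ) - γ + 2 * s) := by
  have hR0 : 0 < R := by linarith
  have h0 : 0 ≤ max s (s / α) := le_max_of_le_left hs
  have h1 : 1 + R ^ α * maxTime α R ≤ 2 * R ^ (min 1 α) := by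
    rw [rpow_mul_maxTime hR]
    have : 1 ≤ R ^ (min 1 α) := Real.one_le_rpow hR (le_min zero_le_one hα.le)
    linarith
  have h2 : 0 ≤ 1 + R ^ α * maxTime α R := by
    have := maxTime_pos α hR
    positivity
  calc timeWeight d α γ s R
      ≤ R ^ ((d : ℝ) - γ) * (2 * R ^ (min 1 α)) ^ (2 * max s (s / α)) := by
        unfold timeWeight
        gcongr
    _ = 2 ^ (2 * max s (s / α)) * (R ^ ((d : ℝ) - γ) * R ^ (2 * (min 1 α * max s (s / α)))) := by
        rw [Real.mul_rpow (by norm_num) (by positivity), ← Real.rpow_mul hR0.le]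
        ring_nf
    _ = _ := by rw [min_mul_max hα hs, ← Real.rpow_add hR0]

theorem volume_maxTime {R : ℝ} (α : ℝ) (hR : 1 ≤ R) :
    volume.real (Icc 0 (maxTime α R)) = maxTime α R := by
  rw [Real.volume_real_Icc_of_le (maxTime_pos α hR).le, sub_zero]

/-- The hypothesis of the converse, on intervals of maximal length and with a constant
proportional to the dimensional constant of the measure. -/
theorem exists_uniform_of_localizedBound (hα : 0 < α)
    (H : ∀ μ : Measure (Space d), IsDimensional γ μ → ∃ C' : ℝ, 0 < C' ∧ ∀ R : ℝ, 1 ≤ R →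
      ∀ I : Set ℝ, I.OrdConnected → I ⊆ Icc 0 1 → R ^ (-α) < volume.real I →
        volume.real I ≤ min (R ^ (1 - α)) 1 → LocalizedBound α γ s C' R I μ) :
    ∃ B : ℝ, 0 ≤ B ∧ ∀ R : ℝ, 1 < R → ∀ (μ : Measure (Space d)) (A : ℝ≥0), BallBound γ μ A →
      MaxBound α (Icc 0 (maxTime α R)) (μ.restrict (Metric.ball 0 1)) R (2 * R)
        (ENNReal.ofReal (B * (timeWeight d α γ s R * A))) := by
  refine exists_uniform_maxBound _ _ (fun R hR => timeWeight_nonneg hR.le) fun μ hμ => ?_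
  obtain ⟨C', hC', h⟩ := H μ hμ
  refine ⟨(2 * Real.pi) ^ d * C' ^ 2 * dimConst γ μ, fun R hR => ?_⟩
  have hR0 : 0 < R := by linarith
  have hvol := volume_maxTime α hR.le
  have h1 := h R hR.le (Icc 0 (maxTime α R)) ordConnected_Icc
    (Icc_subset_Icc_right (min_le_right _ _)) (by
      rw [hvol]
      refine lt_min (Real.rpow_lt_rpow_of_exponent_lt hR (by linarith)) ?_
      exact Real.rpow_lt_one_of_one_lt_of_neg hR (by linarith)) (by rw [hvol]; rfl)
  refine ((localizedBound_iff hR.le hC'.le _ μ).1 h1).mono subset_rfl le_rfl le_rfl le_rfl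
    (le_of_eq ?_)
  rw [hvol]
  congr 1
  unfold timeWeight
  ring

/-- The localized estimate can only hold for `s ≥ 0`: concentrating waves do not decay. -/
theorem nonneg_of_uniform (hα : 0 < α) (hγ : 0 < γ) (hγd : γ ≤ d) {B : ℝ} (hB : 0 ≤ B)
    (H : ∀ R : ℝ, 1 < R → ∀ (μ : Measure (Space d)) (A : ℝ≥0), BallBound γ μ A →
      MaxBound α (Icc 0 (maxTime α R)) (μ.restrict (Metric.ball 0 1)) R (2 * R)
        (ENNReal.ofReal (B * (timeWeight d α γ s R * A)))) : 0 ≤ s := by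
  by_contra! hs
  have hd : 0 < d := by exact_mod_cast hγ.trans_le hγd
  set v := volume.real (Metric.ball (0 : Space d) 1) with hv
  have hv0 : 0 < v :=
    ENNReal.toReal_pos (Metric.measure_ball_pos _ _ one_pos).ne' measure_ball_lt_top.ne
  set σ := 2 * max s (s / α) with hσ
  have hσ0 : σ < 0 := by
    have : max s (s / α) < 0 := max_lt hs (div_neg_of_neg_of_pos hs hα)
    linarith
  have hβ : 0 < min 1 α := lt_min one_pos hα
  have hle : ∀ R : ℝ, 1 < R → v ^ 2 ≤ 4 ^ (d + 1) * (B * v) * R ^ (min 1 α * σ) := by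
    intro R hR
    have hR0 : 0 < R := by linarith
    have h1 := H R hR _ _ (ballBound_smallBall hγ hγd hR.le)
    have hw := timeWeight_nonneg (d := d) (α := α) (γ := γ) (s := s) hR.le
    have h2 := le_of_maxBound_smallBall (S := Icc 0 (maxTime α R)) hd hR.le (by positivity)
      ⟨le_rfl, (maxTime_pos α hR.le).le⟩ h1
    change R ^ ((d : ℝ) - γ) * v ^ 2 ≤ 4 ^ (d + 1) * (B * (timeWeight d α γ s R * v)) at h2
    have h3 : timeWeight d α γ s R ≤ R ^ ((d : ℝ) - γ) * R ^ (min 1 α * σ) := by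
      unfold timeWeight
      rw [rpow_mul_maxTime hR.le, Real.rpow_mul hR0.le]
      refine mul_le_mul_of_nonneg_left ?_ (by positivity)
      exact Real.rpow_le_rpow_of_nonpos (by positivity) (by linarith) hσ0.le
    have hq : 0 < R ^ ((d : ℝ) - γ) := by positivity
    refine le_of_mul_le_mul_left (h2.trans ?_) hq
    calc 4 ^ (d + 1) * (B * (timeWeight d α γ s R * v))
        ≤ 4 ^ (d + 1) * (B * (R ^ ((d : ℝ) - γ) * R ^ (min 1 α * σ) * v)) := by gcongr
      _ = _ := by ring
  have hlim : Filter.Tendsto (fun R : ℝ => 4 ^ (d + 1) * (B * v) * R ^ (min 1 α * σ))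
      Filter.atTop (nhds (4 ^ (d + 1) * (B * v) * 0)) := by
    refine Filter.Tendsto.const_mul _ ?_
    have := tendsto_rpow_neg_atTop (y := -(min 1 α * σ)) (by nlinarith)
    simpa using this
  have := ge_of_tendsto hlim ((Filter.eventually_gt_atTop 1).mono hle)
  rw [mul_zero] at this
  nlinarith

/-- The global estimate for the frequencies `R ≥ 2`. For `α ≤ 1` the interval of maximal length is
the unit interval; for `α ≥ 1` the bounds on short intervals are put together. -/
theorem exists_maxBound_high_frequency (hα : 0 < α) (hγd : γ ≤ d) (hs : 0 ≤ s) {B : ℝ}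
    (hB : 0 ≤ B)
    (H : ∀ R : ℝ, 1 < R → ∀ (μ : Measure (Space d)) (A : ℝ≥0), BallBound γ μ A →
      MaxBound α (Icc 0 (maxTime α R)) (μ.restrict (Metric.ball 0 1)) R (2 * R)
        (ENNReal.ofReal (B * (timeWeight d α γ s R * A)))) :
    ∃ C : ℝ, 0 ≤ C ∧ ∀ R : ℝ, 2 ≤ R → ∀ (μ : Measure (Space d)) (A : ℝ≥0), BallBound γ μ A →
      MaxBound α (Ioc 0 1) (μ.restrict (Metric.ball 0 1)) R (2 * R)
        (ENNReal.ofReal (C * (R ^ ((d : ℝ) - γ + 2 * s) * A))) := by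
  set p : ℝ := (d : ℝ) - γ + 2 * s with hp
  have hp0 : 0 ≤ p := by linarith
  set c : ℝ := 2 ^ (2 * max s (s / α)) with hc
  rcases le_total α 1 with h1 | h1
  · refine ⟨B * c, by positivity, fun R hR μ A hA => ?_⟩
    have hR1 : 1 < R := by linarith
    have hT : maxTime α R = 1 := min_eq_right (Real.one_le_rpow hR1.le (by linarith))
    have h2 := H R hR1 μ A hA
    rw [hT] at h2
    refine h2.mono Ioc_subset_Icc_self le_rfl le_rfl le_rfl (ENNReal.ofReal_le_ofReal ?_)
    calc B * (timeWeight d α γ s R * A) ≤ B * (c * R ^ p * A) := by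
          gcongr
          exact timeWeight_le hα hs hR1.le
      _ = _ := by ring
  · set κ : ℝ := α * (2 ^ |α - 1| * 2 ^ |1 - α|) with hκ
    obtain ⟨Ct, hCtt, hCt⟩ := exists_maxBound_of_short_times d (κ := κ) h1 (by positivity)
    refine ⟨4 * Ct.toReal * (B * (c * 2 ^ p)), by positivity, fun R hR μ A hA => ?_⟩
    have hR0 : 0 < R := by linarith
    set K := Ct * ENNReal.ofReal (B * (c * (2 ^ p * R ^ p) * A)) with hK
    have band : ∀ m : ℝ, R ≤ m → m ≤ 3 / 2 * R →
        MaxBound α (Ioc 0 1) (μ.restrict (Metric.ball 0 1)) m (3 / 2 * m) K := by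
      intro m hm1 hm2
      have hm : 1 ≤ m := by linarith
      have hm0 : 0 < m := by linarith
      set R' := m - 1 / 4 with hR'
      have hR'1 : 1 < R' := by linarith
      have hT : maxTime α R' = R' ^ (1 - α) :=
        min_eq_left (Real.rpow_le_one_of_one_le_of_nonpos hR'1.le (by linarith))
      refine hCt m (3 / 2 * m) _ (maxTime α R') μ _ hA.sFinite hm ?_ (min_le_right _ _)
        (slowSymbol d hα hm) ?_ ?_
      · rw [hT]
        exact Real.rpow_le_rpow_of_nonpos (by linarith) (by linarith) (by linarith)
      · have h3 : R' ^ (1 - α) ≤ 2 ^ |1 - α| * m ^ (1 - α) :=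
          rpow_le_mul_rpow (by norm_num) hm0 (by linarith) (by linarith) _
        have h4 : m ^ (1 - α) * m ^ (α - 1) = 1 := by
          rw [← Real.rpow_add hm0]; simp
        rw [hT]
        calc R' ^ (1 - α) * (α * (2 ^ |α - 1| * m ^ (α - 1)))
            ≤ 2 ^ |1 - α| * m ^ (1 - α) * (α * (2 ^ |α - 1| * m ^ (α - 1))) := by gcongr
          _ = κ * (m ^ (1 - α) * m ^ (α - 1)) := by rw [hκ]; ring
          _ = κ := by rw [h4, mul_one]
      · refine (H R' hR'1 μ A hA).mono subset_rfl le_rfl le_rfl (by linarith)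
          (ENNReal.ofReal_le_ofReal ?_)
        have h5 : R' ^ p ≤ 2 ^ p * R ^ p := by
          rw [← Real.mul_rpow (by norm_num) hR0.le]
          exact Real.rpow_le_rpow (by linarith) (by linarith) hp0
        calc B * (timeWeight d α γ s R' * A) ≤ B * (c * R' ^ p * A) := by
              gcongr
              exact timeWeight_le hα hs hR'1.le
          _ ≤ B * (c * (2 ^ p * R ^ p) * A) := by gcongr
    have hu := (band R le_rfl (by linarith)).union (band (3 / 2 * R) (by linarith) le_rfl)
    refine hu.mono subset_rfl le_rfl le_rfl (by linarith) (le_of_eq ?_)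
    rw [hK]
    nth_rewrite 1 2 [← ENNReal.ofReal_toReal hCtt]
    rw [← ENNReal.ofReal_mul ENNReal.toReal_nonneg, ← ENNReal.ofReal_add (by positivity)
      (by positivity), ← ENNReal.ofReal_ofNat 2, ← ENNReal.ofReal_mul (by norm_num)]
    congr 1
    ring

theorem maximalEstimate_of_localizedBound (hα : 0 < α) (hγ : 0 < γ) (hγd : γ ≤ d)
    (H : ∀ μ : Measure (Space d), IsDimensional γ μ → ∃ C' : ℝ, 0 < C' ∧ ∀ R : ℝ, 1 ≤ R →
      ∀ I : Set ℝ, I.OrdConnected → I ⊆ Icc 0 1 → R ^ (-α) < volume.real I →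
        volume.real I ≤ min (R ^ (1 - α)) 1 → LocalizedBound α γ s C' R I μ) :
    MaximalEstimate d α γ s := by
  obtain ⟨B, hB, hU⟩ := exists_uniform_of_localizedBound hα H
  have hs := nonneg_of_uniform hα hγ hγd hB hU
  obtain ⟨C, hC, hhigh⟩ := exists_maxBound_high_frequency hα hγd hs hB hU
  set V := volume.real (Metric.closedBall (0 : Space d) 4) with hV
  have hV0 : 0 ≤ V := measureReal_nonneg
  refine maximalEstimate_iff.2 ⟨C + V, by positivity, fun R hR μ A hA => ?_⟩
  have hR0 : 0 < R := by linarith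
  rcases le_total 2 R with h2 | h2
  · refine (hhigh R h2 μ A hA).mono subset_rfl le_rfl le_rfl le_rfl (ENNReal.ofReal_le_ofReal ?_)
    gcongr
    linarith
  · refine (maxBound_of_bounded_frequency (b := 4) hA).mono subset_rfl le_rfl le_rfl
      (by linarith) ?_
    have hp : 1 ≤ R ^ ((d : ℝ) - γ + 2 * s) := Real.one_le_rpow hR (by linarith)
    rw [← ofReal_measureReal (measure_closedBall_lt_top.ne), ← ENNReal.ofReal_coe_nnreal,
      ← ENNReal.ofReal_mul hV0]
    refine ENNReal.ofReal_le_ofReal ?_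
    calc V * A = V * (1 * A) := by ring
      _ ≤ (C + V) * (R ^ ((d : ℝ) - γ + 2 * s) * A) := by
          gcongr
          linarith

end Converse

end FractalMaximal

theorem lemma2p2 (d : ℕ) (α γ s : ℝ) (hα : 0 < α) (hγ : 0 < γ) (hγd : γ ≤ d) :
    -- the global-in-time estimate implies the localized one, with a constant uniform in
    -- the scale, the interval, the measure and the function
    (FractalMaximal.MaximalEstimate d α γ s →
      ∃ C' : ℝ, 0 < C' ∧
        ∀ R : ℝ, 1 ≤ R →
          ∀ I : Set ℝ, I.OrdConnected → I ⊆ Set.Icc 0 1 →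
            MeasureTheory.volume.real I ≤ min (R ^ (1 - α)) 1 →
            ∀ μ : MeasureTheory.Measure (FractalMaximal.Space d),
              FractalMaximal.IsDimensional γ μ →
              FractalMaximal.LocalizedBound α γ s C' R I μ) ∧
    -- conversely; here the constant in the hypothesis may even depend on the measure
    ((∀ μ : MeasureTheory.Measure (FractalMaximal.Space d),
        FractalMaximal.IsDimensional γ μ →
        ∃ C' : ℝ, 0 < C' ∧
          ∀ R : ℝ, 1 ≤ R →
            ∀ I : Set ℝ, I.OrdConnected → I ⊆ Set.Icc 0 1 →
              R ^ (-α) < MeasureTheory.volume.real I →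
              MeasureTheory.volume.real I ≤ min (R ^ (1 - α)) 1 →
              FractalMaximal.LocalizedBound α γ s C' R I μ) →
      FractalMaximal.MaximalEstimate d α γ s) := by
  refine ⟨fun h => ?_, FractalMaximal.maximalEstimate_of_localizedBound hα hγ hγd⟩
  obtain ⟨C', hC', h'⟩ := FractalMaximal.exists_localizedBound_of_maximalEstimate hα h
  exact ⟨C', hC', fun R hR I hI hI1 _ => h' R hR I hI hI1⟩
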